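/- Let $n\ge 3$ and $r\ge 2$ be integers. For $\alpha\in\{1,\dots,n\}$ let $F_r^{(\alpha)}$ be a free group with basis $a_1^{(\alpha)},\dots,a_r^{(\alpha)}$, let $$\psi\colon F_r^{(1)}\times\cdots\times F_r^{(n)}\to\mathbb Z^r$$ be the homomorphism that sends every $a_i^{(\alpha)}$ to the $i$-th basis vector $e_i$, and let $K_r^n(r)=\ker\psi$. Put $x_i^{(\alpha)}=a_i^{(\alpha)}(a_i^{(n)})^{-1}\in K_r^n(r)$ for $1\le\alpha\le n-1$ and $1\le i\le r$, and let $\mathcal X_r=\{x_i^{(\alpha)}: 1\le\alpha\le n-1,\ 1\le i\le r\}$. Write $[g,h]=ghg^{-1}h^{-1}$. In the free group $F(\mathcal X_r)$ consider the following sets of words, in which $x_i=x_i^{(\alpha)}$, $y_i=x_i^{(\beta)}$, $z_i=x_i^{(\gamma)}$; $\alpha,\beta,\gamma$ range over pairwise distinct elements of $\{1,\dots,n-1\}$; $i,j,k,h$ range over pairwise distinct elements of $\{1,\dots,r\}$; and $\epsilon,\delta,\sigma,\tau$ range over $\{1,-1\}$: \begin{align*} \mathcal R_{r,1}^n&=\{[x_i,y_i]\},\\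 \mathcal R_{r,2}^n&=\{[x_i,y_jz_j^{-1}]\},\\ \mathcal R_{r,3}^n&=\{[x_i^{\epsilon},y_j^{\delta}]\,[x_j^{\delta},y_i^{\epsilon}]\},\\ \mathcal R_{r,4}^n&=\{[x_i,[y_j^{\epsilon},x_k^{\delta}y_k^{-\delta}]]\},\\ \mathcal R_{r,5}^n&=\{[[x_i^{\epsilon},x_k^{\delta}y_k^{-\delta}],[y_j^{\sigma},x_h^{\tau}y_h^{-\tau}]]\} \end{align*} (in each set only the indices that occur in it are quantified, so a set is empty if there are not enough distinct values for them). Let $$\mathcal R_r^3=\mathcal R_{r,1}^3\cup\mathcal R_{r,3}^3\cup\mathcal R_{r,4}^3\cup\mathcal R_{r,5}^3,\qquad \mathcal R_r^4=\mathcal R_{r,1}^4\cup\mathcal R_{r,2}^4\cup\mathcal R_{r,4}^4,\qquad \mathcal R_r^n=\mathcal R_{r,1}^n\cup\mathcal R_{r,2}^n\quad(n\ge5).$$ Then $\langle\mathcal X_r\mid\mathcal R_r^n\rangle$ is a (finite) presentation of $K_r^n(r)$, and the Dehn function of $K_r^n(r)$ satisfies $$\delta_{K_r^n(r)}(N)\preccurlyeq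 N^{d_n+2},\qquad\text{where } d_3=7,\quad d_4=3,\quad d_n=2\text{ for }n\ge5.$$ Here the Dehn function of a finite presentation $\langle S\mid\mathcal R\rangle$ of a group $G$ is $$\delta(N)=\max\{\operatorname{Area}_{\mathcal R}(w): w\in F(S),\ |w|\le N,\ w=_G1\},$$ where $\operatorname{Area}_{\mathcal R}(w)$ is the least $M$ such that $w=\prod_{i=1}^M u_i^{-1}R_iu_i$ with $u_i\in F(S)$ and $R_i\in\mathcal R\cup\mathcal R^{-1}$; and $f\preccurlyeq g$ means that there is a constant $C>0$ with $f(N)\le C\,g(CN+C)+CN+C$ for all integers $N>0$. The bound holds for the Dehn function of every finite presentation of $K_r^n(r)$. -/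

import Mathlib

open scoped commutatorElement

/-! ### Presentations, area and Dehn functions -/

/-- The family `ι : S → G` of generators and the set `R` of relators give a presentation
`⟨S | R⟩` of the group `G`. -/
def IsPresentation {S G : Type*} [Group G] (ι : S → G) (R : Set (FreeGroup S)) : Prop :=
  Function.Surjective (FreeGroup.lift ι) ∧
    (FreeGroup.lift ι).ker = Subgroup.normalClosure R

/-- `⟨S | R⟩` is a presentation of `G` with finitely many generators and relators. -/
def IsFinitePresentation {S G : Type*} [Group G] (ι : S → G) (R : Set (FreeGroup S)) : Prop :=
  Finite S ∧ R.Finite ∧ IsPresentation ι R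

/-- `Area_R(w)`: the least number `M` of factors in an expression
`w = ∏_{i=1}^M u_i⁻¹ R_i u_i` in which every `R_i` is an element of `R` or the inverse of one.
It is `⊤` when there is no such expression. -/
noncomputable def area {S : Type*} (R : Set (FreeGroup S)) (w : FreeGroup S) : ℕ∞ :=
  ⨅ (l : List (FreeGroup S × FreeGroup S))
    (_ : (∀ p ∈ l, p.2 ∈ R ∨ p.2⁻¹ ∈ R) ∧ (l.map fun p => p.1⁻¹ * p.2 * p.1).prod = w),
    (l.length : ℕ∞)

/-- The Dehn function of the presentation `⟨S | R⟩` of `G`: the supremum of the areas of the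
words of length at most `N` that represent the trivial element of `G`. -/
noncomputable def dehnFunction {S G : Type*} [DecidableEq S] [Group G]
    (ι : S → G) (R : Set (FreeGroup S)) (N : ℕ) : ℕ∞ :=
  ⨆ (w : FreeGroup S) (_ : w.norm ≤ N ∧ FreeGroup.lift ι w = 1), area R w

/-- The asymptotic comparison `f ≼ g`: there is a constant `C > 0` such that
`f N ≤ C g(C N + C) + C N + C` for all `N > 0`. The left-hand function may a priori take the
value `⊤`; the comparison forces it to be finite at every `N > 0`. -/
def AsympLE (f : ℕ → ℕ∞) (g : ℕ → ℕ) : Prop :=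
  ∃ C : ℕ, 0 < C ∧ ∀ N : ℕ, 0 < N → f N ≤ ((C * g (C * N + C) + C * N + C : ℕ) : ℕ∞)

/-- `δ_G ≼ g`. The Dehn function of `G` is only defined up to equivalence, so the comparison is
asked of the Dehn function of every finite presentation of `G`. -/
def DehnFunctionLE (G : Type*) [Group G] (g : ℕ → ℕ) : Prop :=
  ∀ (S : Type) [DecidableEq S] (ι : S → G) (R : Set (FreeGroup S)),
    IsFinitePresentation ι R → AsympLE (dehnFunction ι R) g

/-! ### The kernel of `F_r × ⋯ × F_r → ℤ^r` -/

/-- The direct product of `n` free groups of rank `r`. -/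
abbrev FreeProd (n r : ℕ) : Type := Fin n → FreeGroup (Fin r)

/-- The generator `a_i^{(α)}` of the `α`-th factor, as an element of the product. -/
def factorGen {n r : ℕ} (α : Fin n) (i : Fin r) : FreeProd n r :=
  Pi.mulSingle α (FreeGroup.of i)

/-- The homomorphism `ψ : F_r × ⋯ × F_r → ℤ^r` that sends each `a_i^{(α)}` to `e_i`
(see `psi_factorGen`). -/
def psi (n r : ℕ) : FreeProd n r →* Multiplicative (Fin r → ℤ) :=
  ∏ α : Fin n, (FreeGroup.lift fun i : Fin r =>
    Multiplicative.ofAdd (Pi.single i (1 : ℤ) : Fin r → ℤ)).comp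
      (Pi.evalMonoidHom (fun _ : Fin n => FreeGroup (Fin r)) α)

theorem psi_factorGen {n r : ℕ} (α : Fin n) (i : Fin r) :
    psi n r (factorGen α i) = Multiplicative.ofAdd (Pi.single i (1 : ℤ)) := by
  rw [psi, MonoidHom.finsetProd_apply, Finset.prod_eq_single α]
  · simp [factorGen]
  · intro β _ hβ
    simp [factorGen, Pi.mulSingle_eq_of_ne hβ]
  · simp

/-- `K_r^n(r) = ker ψ`. -/
abbrev kernelK (n r : ℕ) : Subgroup (FreeProd n r) := (psi n r).ker

/-- The `α`-th factor, for `α` among the first `n - 1`. -/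
def firstFactor {n : ℕ} (α : Fin (n - 1)) : Fin n := α.castLE (Nat.sub_le n 1)

/-- The last factor; `α` only witnesses that `n ≠ 0`. -/
def lastFactor {n : ℕ} (α : Fin (n - 1)) : Fin n := ⟨n - 1, by have := α.isLt; omega⟩

/-- `x_i^{(α)} = a_i^{(α)} (a_i^{(n)})⁻¹ ∈ K_r^n(r)`, for `α` among the first `n - 1` factors. -/
def kernelGen (n r : ℕ) (p : Fin (n - 1) × Fin r) : kernelK n r :=
  ⟨factorGen (firstFactor p.1) p.2 * (factorGen (lastFactor p.1) p.2)⁻¹, by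
    rw [MonoidHom.mem_ker, map_mul, map_inv, psi_factorGen, psi_factorGen, mul_inv_cancel]⟩

/-! ### The relators

The alphabet consists of the letters `x_i^{(α)}` with `α ∈ {1, …, n-1}` and `i ∈ {1, …, r}`.
Signs `ε, δ, σ, τ ∈ {1, -1}` are elements of `ℤˣ`, and `⁅g, h⁆ = g h g⁻¹ h⁻¹`. -/

/-- The free group on the letters `x_i^{(α)}`. -/
abbrev KernelWord (n r : ℕ) : Type := FreeGroup (Fin (n - 1) × Fin r)

/-- The letter `x_i^{(α)}`. -/
def letter {n r : ℕ} (α : Fin (n - 1)) (i : Fin r) : KernelWord n r := FreeGroup.of (α, i)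

/-- `[x_i, y_i]` -/
def relSimple (n r : ℕ) : Set (KernelWord n r) :=
  {w | ∃ (i : Fin r) (α β : Fin (n - 1)), α ≠ β ∧
    w = ⁅letter α i, letter β i⁆}

/-- `[x_i, y_j z_j⁻¹]` -/
def relComm (n r : ℕ) : Set (KernelWord n r) :=
  {w | ∃ (i j : Fin r) (α β γ : Fin (n - 1)), i ≠ j ∧ α ≠ β ∧ α ≠ γ ∧ β ≠ γ ∧
    w = ⁅letter α i, letter β j * (letter γ j)⁻¹⁆}

/-- `[x_i^ε, y_j^δ] [x_j^δ, y_i^ε]` -/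
def relSwap (n r : ℕ) : Set (KernelWord n r) :=
  {w | ∃ (i j : Fin r) (α β : Fin (n - 1)) (ε δ : ℤˣ), i ≠ j ∧ α ≠ β ∧
    w = ⁅letter α i ^ (ε : ℤ), letter β j ^ (δ : ℤ)⁆ *
      ⁅letter α j ^ (δ : ℤ), letter β i ^ (ε : ℤ)⁆}

/-- `[x_i, [y_j^ε, x_k^δ y_k^{-δ}]]` -/
def relTriple (n r : ℕ) : Set (KernelWord n r) :=
  {w | ∃ (i j k : Fin r) (α β : Fin (n - 1)) (ε δ : ℤˣ),
    i ≠ j ∧ i ≠ k ∧ j ≠ k ∧ α ≠ β ∧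
    w = ⁅letter α i,
      ⁅letter β j ^ (ε : ℤ), letter α k ^ (δ : ℤ) * (letter β k)⁻¹ ^ (δ : ℤ)⁆⁆}

/-- `[[x_i^ε, x_k^δ y_k^{-δ}], [y_j^σ, x_h^τ y_h^{-τ}]]` -/
def relQuad (n r : ℕ) : Set (KernelWord n r) :=
  {w | ∃ (i j k h : Fin r) (α β : Fin (n - 1)) (ε δ σ τ : ℤˣ),
    i ≠ j ∧ i ≠ k ∧ i ≠ h ∧ j ≠ k ∧ j ≠ h ∧ k ≠ h ∧ α ≠ β ∧
    w = ⁅⁅letter α i ^ (ε : ℤ), letter α k ^ (δ : ℤ) * (letter β k)⁻¹ ^ (δ : ℤ)⁆,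
      ⁅letter β j ^ (σ : ℤ), letter α h ^ (τ : ℤ) * (letter β h)⁻¹ ^ (τ : ℤ)⁆⁆}

/-- The set of relators `R_r^n` (only meaningful for `n ≥ 3`). -/
def relators (n r : ℕ) : Set (KernelWord n r) :=
  if n = 3 then relSimple n r ∪ relSwap n r ∪ relTriple n r ∪ relQuad n r
  else if n = 4 then relSimple n r ∪ relComm n r ∪ relTriple n r
  else relSimple n r ∪ relComm n r

/-- `d_3 = 7`, `d_4 = 3` and `d_n = 2` for `n ≥ 5`. -/
def dExp (n : ℕ) : ℕ := if n = 3 then 7 else if n = 4 then 3 else 2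

/-!
Let `n ≥ 3`. The letters `a_i^{(α)}` of the first `n - 1` factors together with the letters `b_i =
(a_i^{(n)})⁻¹` of the last factor present the product of free groups, with the commutators of
letters from different factors as relators. A word that is trivial in the product is trivial in each
factor, so it can be reduced by collecting the letters of one factor after the other, which takes
`O(N²)` commutator squares. The proof pushes such a filling into the kernel.

The height of an element of the product is minus its image under `ψ`, and `σ(v) = ∏ b_i ^ v_i` has
height `v`. A letter `a` from height `v` to height `v'` is pushed to the element `σ(v) a σ(v')⁻¹` of
the kernel, written as an explicit word in the letters `x_i^{(α)}` (`pushLetter`). This extends to a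
crossed homomorphism on words (`crossed`), which is the identity on the spellings `a_i^{(α)} b_i` of
the `x_i^{(α)}` (`crossed_spell`). Hence the area of a word of length `N` in the kernel is at most
`O(N²)` times the largest area of a pushed square at height `O(N)` (`area_crossed_mk_le`), and it
remains to bound the latter by `O(N ^ d)` (`exists_area_square_le`).

The sides of a pushed square are conjugates and commutators of letters with products of boundedly
many powers of letters, with exponents `O(N)`. Families of words are treated modulo the normal
subgroup `negligible` of the families of area `O(N ^ d)`. There, raising a congruence to the power
`O(N)` raises the degree by one (`Cong.vpow`), and separating the powers in `(f g) ^ e` for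
commuting `f` and `g` raises it by two (`Comm.mul_vpow`); any relation with constant entries can be
derived in ordinary group theory at degree `0`. What the squares need is collected in
`PushRelations`, from which `pushLetter_square` and `pushLetter_square_last` follow. The colours are
the first `n - 1` factors.

* For `n ≥ 5` a fourth colour is available. A product of powers in two colours is compared by
  inserting powers of the fourth, and only constant commutation relations are ever raised to powers;
  this gives `d = 2` (`comm_vpow_of_four_colours`).
* For `n = 4` the commutators `[y(w)⁻¹, y_k⁻¹ z_k]` commute with the letters of the other two
  colours at degree `2`, which gives `d = 3` (`comm_of_three_colours`).
* For `n = 3` the two colours `x`, `y` and `u = x y⁻¹` form a `Triad`: `x_i = y_i u_i`, and the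
  commutators `[x_i, y_j]` and `[x_k, u_l]` involve only one factor each. The power of `x_j` in a
  commutator is split into powers of `y_j` and `u_j`, one of which cancels (`comm_commutator_vpow`).
  Two such steps lead to degree `5`, which is less than the claimed `7`
  (`pushRelations_of_pairRelations`).

Since every word that is trivial in the kernel has finite area, the relators present the kernel
(`isFinitePresentation_kernelK`). The bound passes to all other finite presentations by
`dehnFunctionLE_of_area_le`.
-/

/-! ### Area as a conjugation-invariant length -/

section Area

variable {S : Type*} {R : Set (FreeGroup S)}

theorem area_le_iff {w : FreeGroup S} {k : ℕ} :
    area R w ≤ k ↔ ∃ l : List (FreeGroup S × FreeGroup S),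
      ((∀ p ∈ l, p.2 ∈ R ∨ p.2⁻¹ ∈ R) ∧ (l.map fun p => p.1⁻¹ * p.2 * p.1).prod = w) ∧
        l.length ≤ k := by
  constructor
  · intro h
    have h1 : area R w < ((k + 1 : ℕ) : ℕ∞) :=
      lt_of_le_of_lt h (by exact_mod_cast Nat.lt_succ_self k)
    simp only [area, iInf_lt_iff] at h1
    obtain ⟨l, hl, h2⟩ := h1
    exact ⟨l, hl, Nat.lt_succ_iff.mp (by exact_mod_cast h2)⟩
  · rintro ⟨l, hl, h⟩
    exact (iInf₂_le l hl).trans (by exact_mod_cast h)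

theorem area_one_le : area R 1 ≤ (0 : ℕ) := area_le_iff.mpr ⟨[], by simp⟩

theorem area_le_one_of_mem {w : FreeGroup S} (h : w ∈ R) : area R w ≤ (1 : ℕ) :=
  area_le_iff.mpr ⟨[(1, w)], by simp [h]⟩

theorem area_mul_le {v w : FreeGroup S} {k l : ℕ} (hv : area R v ≤ k) (hw : area R w ≤ l) :
    area R (v * w) ≤ (k + l : ℕ) := by
  obtain ⟨a, ⟨ha, ha'⟩, hk⟩ := area_le_iff.mp hv
  obtain ⟨b, ⟨hb, hb'⟩, hl⟩ := area_le_iff.mp hw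
  refine area_le_iff.mpr ⟨a ++ b, ⟨?_, ?_⟩, ?_⟩
  · intro p hp
    rcases List.mem_append.mp hp with h | h
    exacts [ha p h, hb p h]
  · simp [ha', hb']
  · simp only [List.length_append]; omega

theorem area_inv_le {w : FreeGroup S} {k : ℕ} (hw : area R w ≤ k) : area R w⁻¹ ≤ k := by
  obtain ⟨a, ⟨ha, ha'⟩, hk⟩ := area_le_iff.mp hw
  refine area_le_iff.mpr ⟨(a.map fun p => (p.1, p.2⁻¹)).reverse, ⟨?_, ?_⟩, by simpa using hk⟩
  · intro p hp
    simp only [List.mem_reverse, List.mem_map] at hp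
    obtain ⟨q, hq, rfl⟩ := hp
    simpa [or_comm] using ha q hq
  · rw [← ha', List.prod_inv_reverse]
    simp [List.map_reverse, Function.comp_def, mul_assoc]

theorem area_conj_le {w : FreeGroup S} {k : ℕ} (g : FreeGroup S) (hw : area R w ≤ k) :
    area R (g * w * g⁻¹) ≤ k := by
  obtain ⟨a, ⟨ha, ha'⟩, hk⟩ := area_le_iff.mp hw
  refine area_le_iff.mpr ⟨a.map fun p => (p.1 * g⁻¹, p.2), ⟨?_, ?_⟩, by simpa using hk⟩
  · intro p hp
    simp only [List.mem_map] at hp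
    obtain ⟨q, hq, rfl⟩ := hp
    exact ha q hq
  · rw [← ha']
    clear ha ha' hk
    induction a with
    | nil => simp
    | cons p a ih =>
      simp only [List.map_cons, List.prod_cons, List.map_map] at ih ⊢
      rw [ih]
      group

theorem mem_normalClosure_of_area_le {w : FreeGroup S} {k : ℕ} (hw : area R w ≤ k) :
    w ∈ Subgroup.normalClosure R := by
  obtain ⟨a, ⟨ha, rfl⟩, -⟩ := area_le_iff.mp hw
  refine Subgroup.list_prod_mem _ fun x hx => ?_
  obtain ⟨p, hp, rfl⟩ := List.mem_map.mp hx
  have h2 : p.2 ∈ Subgroup.normalClosure R := by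
    rcases ha p hp with h | h
    · exact Subgroup.subset_normalClosure h
    · exact (Subgroup.inv_mem_iff _).mp (Subgroup.subset_normalClosure h)
  simpa using Subgroup.normalClosure_normal.conj_mem _ h2 p.1⁻¹

theorem exists_area_le_of_mem_normalClosure {w : FreeGroup S}
    (hw : w ∈ Subgroup.normalClosure R) : ∃ k : ℕ, area R w ≤ k := by
  let H : Subgroup (FreeGroup S) :=
    { carrier := {w | ∃ k : ℕ, area R w ≤ k}
      one_mem' := ⟨0, area_one_le⟩
      mul_mem' := fun ⟨k, hk⟩ ⟨l, hl⟩ => ⟨k + l, area_mul_le hk hl⟩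
      inv_mem' := fun ⟨k, hk⟩ => ⟨k, area_inv_le hk⟩ }
  have hH : H.Normal := ⟨fun w ⟨k, hk⟩ g => ⟨k, area_conj_le g hk⟩⟩
  exact Subgroup.normalClosure_le_normal (N := H) (fun w h => ⟨1, area_le_one_of_mem h⟩) hw

theorem area_mono {w : FreeGroup S} {k l : ℕ} (h : area R w ≤ k) (hkl : k ≤ l) :
    area R w ≤ l := h.trans (by exact_mod_cast hkl)

theorem area_pow_mul_inv_pow_le {v w : FreeGroup S} {k : ℕ} (h : area R (v * w⁻¹) ≤ k) (n : ℕ) :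
    area R (v ^ n * (w ^ n)⁻¹) ≤ (n * k : ℕ) := by
  induction n with
  | zero => simpa using area_one_le
  | succ n ih =>
    rw [show v ^ (n + 1) * (w ^ (n + 1))⁻¹ = v * (v ^ n * (w ^ n)⁻¹) * v⁻¹ * (v * w⁻¹) by
      rw [pow_succ', pow_succ']; group]
    exact area_mono (area_mul_le (area_conj_le _ ih) h) (by ring_nf; omega)

theorem area_zpow_mul_inv_zpow_le {v w : FreeGroup S} {k : ℕ} (h : area R (v * w⁻¹) ≤ k) (n : ℤ) :
    area R (v ^ n * (w ^ n)⁻¹) ≤ (n.natAbs * k : ℕ) := by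
  obtain ⟨m, rfl | rfl⟩ := n.eq_nat_or_neg
  · simpa using area_pow_mul_inv_pow_le h m
  · have h2 := area_inv_le (area_conj_le ((w ^ m)⁻¹) (area_pow_mul_inv_pow_le h m))
    simp only [zpow_neg, zpow_natCast, Int.natAbs_neg, Int.natAbs_natCast]
    convert h2 using 1
    group

theorem area_commutator_pow_le {v w : FreeGroup S} {k : ℕ} (h : area R ⁅v, w⁆ ≤ k) (n : ℕ) :
    area R ⁅v, w ^ n⁆ ≤ (n * k : ℕ) := by
  have h1 : area R (v * w * v⁻¹ * w⁻¹) ≤ k := h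
  have := area_pow_mul_inv_pow_le h1 n
  rwa [conj_pow] at this

/-- Separating the powers in `(v w) ^ n` takes `n ^ 2` commutations of `v` with `w`; this is where
the degree of an area bound goes up by two. -/
theorem area_mul_pow_le {v w : FreeGroup S} {k : ℕ} (h : area R ⁅w, v⁆ ≤ k) (n : ℕ) :
    area R ((v * w) ^ n * (v ^ n * w ^ n)⁻¹) ≤ (n * (n * k) : ℕ) := by
  induction n with
  | zero => simpa using area_one_le
  | succ n ih =>
    rw [show (v * w) ^ (n + 1) * (v ^ (n + 1) * w ^ (n + 1))⁻¹ =
      v * (w * ((v * w) ^ n * (v ^ n * w ^ n)⁻¹) * w⁻¹ * ⁅w, v ^ n⁆) * v⁻¹ by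
      rw [pow_succ' (v * w), pow_succ v, pow_succ w, commutatorElement_def]; group]
    exact area_mono (area_conj_le _ (area_mul_le (area_conj_le _ ih) (area_commutator_pow_le h n)))
      (by ring_nf; omega)

theorem area_mul_zpow_le {v w : FreeGroup S} {k : ℕ} (h : area R ⁅w, v⁆ ≤ k) (n : ℤ) :
    area R ((v * w) ^ n * (v ^ n * w ^ n)⁻¹) ≤ (2 * (n.natAbs * (n.natAbs * k)) : ℕ) := by
  obtain ⟨m, rfl | rfl⟩ := n.eq_nat_or_neg
  · simp only [zpow_natCast, Int.natAbs_natCast]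
    exact area_mono (area_mul_pow_le h m) (by omega)
  · have h1 : area R ⁅v ^ m, w⁆ ≤ (m * k : ℕ) := by
      rw [← commutatorElement_inv]; exact area_inv_le (area_commutator_pow_le h m)
    have h2 := area_conj_le ((v ^ m * w ^ m)⁻¹) (area_inv_le (area_commutator_pow_le h1 m))
    have h3 := area_conj_le ((v * w) ^ m)⁻¹ (area_inv_le (area_mul_pow_le h m))
    simp only [zpow_neg, zpow_natCast, Int.natAbs_neg, Int.natAbs_natCast]
    refine area_mono (k := m * (m * k) + m * (m * k)) ?_ (by omega)
    convert area_mul_le h3 h2 using 2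
    rw [commutatorElement_def]
    group

end Area

/-! ### Families of words modulo polynomially bounded area -/

section Negligible

variable {S T : Type*}

/-- The families `f : T → FreeGroup S` of words whose area grows at most like the `d`-th power of
the size function `N`. The use of `N t + 1` makes these subgroups increase with `d` without any
assumption on `N`. -/
def negligible (R : Set (FreeGroup S)) (N : T → ℕ) (d : ℕ) : Subgroup (T → FreeGroup S) where
  carrier := {f | ∃ C : ℕ, ∀ t, area R (f t) ≤ (C * (N t + 1) ^ d : ℕ)}
  one_mem' := ⟨0, fun _ => by simpa using area_one_le⟩
  mul_mem' := fun ⟨C, hC⟩ ⟨C', hC'⟩ => ⟨C + C', fun t =>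
    area_mono (area_mul_le (hC t) (hC' t)) (by rw [add_mul])⟩
  inv_mem' := fun ⟨C, hC⟩ => ⟨C, fun t => area_inv_le (hC t)⟩

variable {R : Set (FreeGroup S)} {N : T → ℕ}

instance (d : ℕ) : (negligible R N d).Normal :=
  ⟨fun _ ⟨C, hC⟩ _ => ⟨C, fun t => area_conj_le _ (hC t)⟩⟩

theorem negligible_mono {d d' : ℕ} (h : d ≤ d') : negligible R N d ≤ negligible R N d' := by
  rintro f ⟨C, hC⟩
  exact ⟨C, fun t => area_mono (hC t)
    (Nat.mul_le_mul_left _ (Nat.pow_le_pow_right (Nat.succ_pos _) h))⟩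

/-- The pointwise power of a family by a family of exponents. -/
def vpow (f : T → FreeGroup S) (e : T → ℤ) : T → FreeGroup S := fun t => f t ^ e t

/-- The families of exponents that are bounded by the size function. -/
def Bounded (N : T → ℕ) (e : T → ℤ) : Prop := ∀ t, (e t).natAbs ≤ N t + 1

theorem Bounded.neg {e : T → ℤ} (h : Bounded N e) : Bounded N (-e) := fun t => by
  simpa using h t

theorem bounded_one : Bounded N 1 := fun t => by simp

theorem vpow_one (f : T → FreeGroup S) : vpow f 1 = f := by ext t; simp [vpow]

theorem vpow_neg (f : T → FreeGroup S) (e : T → ℤ) : vpow f (-e) = (vpow f e)⁻¹ := by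
  ext1 t; simp [vpow]

theorem vpow_inv (f : T → FreeGroup S) (e : T → ℤ) : vpow f⁻¹ e = (vpow f e)⁻¹ := by
  ext1 t; simp [vpow]

theorem conj_vpow (g f : T → FreeGroup S) (e : T → ℤ) :
    vpow (g * f * g⁻¹) e = g * vpow f e * g⁻¹ := by
  ext1 t; simp [vpow, conj_zpow]

variable (R N) in
/-- The class of a family of words modulo the families of area `O(N ^ d)`. -/
def cls (d : ℕ) : (T → FreeGroup S) →* (T → FreeGroup S) ⧸ negligible R N d :=
  QuotientGroup.mk' _

/-- Two families are congruent if their quotient has area `O(N ^ d)`. -/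
abbrev Cong (R : Set (FreeGroup S)) (N : T → ℕ) (d : ℕ) (f g : T → FreeGroup S) : Prop :=
  cls R N d f = cls R N d g

/-- Two families commute up to a commutator of area `O(N ^ d)`. -/
abbrev Comm (R : Set (FreeGroup S)) (N : T → ℕ) (d : ℕ) (f g : T → FreeGroup S) : Prop :=
  Commute (cls R N d f) (cls R N d g)

theorem cong_iff {d : ℕ} {f g : T → FreeGroup S} :
    Cong R N d f g ↔ f * g⁻¹ ∈ negligible R N d := by
  rw [Cong, cls, ← mul_inv_eq_one, ← map_inv, ← map_mul]
  exact QuotientGroup.eq_one_iff _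

theorem comm_iff_cong {d : ℕ} {f g : T → FreeGroup S} :
    Comm R N d f g ↔ Cong R N d (f * g) (g * f) := by
  rw [Comm, Cong, map_mul, map_mul]; rfl

theorem Cong.mono {d d' : ℕ} {f g : T → FreeGroup S} (h : Cong R N d f g) (hd : d ≤ d') :
    Cong R N d' f g := cong_iff.mpr (negligible_mono hd (cong_iff.mp h))

theorem Comm.mono {d d' : ℕ} {f g : T → FreeGroup S} (h : Comm R N d f g) (hd : d ≤ d') :
    Comm R N d' f g := comm_iff_cong.mpr ((comm_iff_cong.mp h).mono hd)

theorem Cong.vpow {d : ℕ} {f g : T → FreeGroup S} (h : Cong R N d f g) {e : T → ℤ}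
    (he : Bounded N e) : Cong R N (d + 1) (vpow f e) (vpow g e) := by
  obtain ⟨C, hC⟩ := cong_iff.mp h
  refine cong_iff.mpr ⟨C, fun t => area_mono (area_zpow_mul_inv_zpow_le (hC t) (e t)) ?_⟩
  calc (e t).natAbs * (C * (N t + 1) ^ d) ≤ (N t + 1) * (C * (N t + 1) ^ d) :=
        Nat.mul_le_mul_right _ (he t)
    _ = C * (N t + 1) ^ (d + 1) := by ring

theorem Comm.vpow_left {d : ℕ} {f g : T → FreeGroup S} (h : Comm R N d f g) {e : T → ℤ}
    (he : Bounded N e) : Comm R N (d + 1) (vpow f e) g := by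
  have h1 : Cong R N d (g * f * g⁻¹) f := by
    simp only [Cong, map_mul, map_inv]
    exact mul_inv_eq_of_eq_mul h.eq.symm
  have h2 := h1.vpow he
  rw [conj_vpow] at h2
  simp only [Cong, map_mul, map_inv] at h2
  exact (mul_inv_eq_iff_eq_mul.mp h2).symm

theorem Comm.vpow_right {d : ℕ} {f g : T → FreeGroup S} (h : Comm R N d f g) {e : T → ℤ}
    (he : Bounded N e) : Comm R N (d + 1) f (vpow g e) :=
  (Comm.vpow_left h.symm he).symm

/-- Powers of a product of commuting families may be rearranged at the price of two degrees. -/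
theorem Comm.mul_vpow {d : ℕ} {f g : T → FreeGroup S} (h : Comm R N d f g) {e : T → ℤ}
    (he : Bounded N e) : Cong R N (d + 2) (vpow (f * g) e) (vpow f e * vpow g e) := by
  have h1 := comm_iff_cong.mp h.symm
  rw [cong_iff, show g * f * (f * g)⁻¹ = ⁅g, f⁆ by rw [commutatorElement_def]; group] at h1
  obtain ⟨C, hC⟩ := h1
  refine cong_iff.mpr ⟨2 * C, fun t => area_mono (area_mul_zpow_le (hC t) (e t)) ?_⟩
  calc 2 * ((e t).natAbs * ((e t).natAbs * (C * (N t + 1) ^ d)))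
      ≤ 2 * ((N t + 1) * ((N t + 1) * (C * (N t + 1) ^ d))) := by gcongr <;> exact he t
    _ = 2 * C * (N t + 1) ^ (d + 2) := by ring

variable (R N) in
/-- The class of a constant family. -/
def constCls : FreeGroup S →* (T → FreeGroup S) ⧸ negligible R N 0 :=
  (cls R N 0).comp (Pi.constMonoidHom T (FreeGroup S))

theorem constCls_eq_one {w : FreeGroup S} (h : w ∈ R) : constCls R N w = 1 := by
  have : Cong R N 0 (fun _ => w) 1 := cong_iff.mpr ⟨1, fun t => by
    simpa using area_le_one_of_mem h⟩
  rw [Cong, map_one] at this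
  exact this

end Negligible

/-! ### Identities for commutators -/

section GroupIdentities

variable {H : Type*} [Group H]

/-- Since `[c, b⁻¹] = (b⁻¹ [c, b] b)⁻¹` and `[d, a⁻¹] = (a⁻¹ [d, a] a)⁻¹`, the hypotheses say that
`a` and `b` conjugate `[c, b] = [d, a]` in the same way. -/
theorem commute_commutator_of_swap {a b c d : H} (h : ⁅c, b⁆ = ⁅d, a⁆) (h' : ⁅c, b⁻¹⁆ = ⁅d, a⁻¹⁆) :
    Commute (a * b⁻¹) ⁅c, b⁆ := by
  have h1 : b⁻¹ * ⁅c, b⁆ * b = a⁻¹ * ⁅c, b⁆ * a := by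
    have e1 : b⁻¹ * ⁅c, b⁆ * b = ⁅c, b⁻¹⁆⁻¹ := by simp only [commutatorElement_def]; group
    have e2 : a⁻¹ * ⁅d, a⁆ * a = ⁅d, a⁻¹⁆⁻¹ := by simp only [commutatorElement_def]; group
    rw [e1, h', ← e2, h]
  have h2 : a * (b⁻¹ * ⁅c, b⁆ * b) * a⁻¹ = ⁅c, b⁆ := by rw [h1]; group
  show a * b⁻¹ * ⁅c, b⁆ = ⁅c, b⁆ * (a * b⁻¹)
  conv_rhs => rw [← h2]
  group

/-- A consequence of the Hall–Witt identity. -/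
theorem commute_commutator_of_hallWitt {x y z : H} (h1 : Commute ⁅y⁻¹, z⁻¹⁆ x)
    (h2 : Commute ⁅z, x⁻¹⁆ y) : Commute z ⁅x, y⁆ := by
  have key : y⁻¹ * ⁅⁅x, y⁆⁻¹, z⁆ * y * (z * ⁅⁅y⁻¹, z⁻¹⁆⁻¹, x⁆ * z⁻¹) *
      (x * ⁅⁅z, x⁻¹⁆⁻¹, y⁻¹⁆ * x⁻¹) = 1 := by
    simp only [commutatorElement_def]; group
  rw [commutatorElement_eq_one_iff_commute.mpr h1.inv_left,
    commutatorElement_eq_one_iff_commute.mpr h2.inv_inv] at key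
  have : ⁅⁅x, y⁆⁻¹, z⁆ = 1 := by
    have := congrArg (fun t => y * t * y⁻¹) key
    simpa [mul_assoc] using this
  exact (Commute.inv_left_iff.mp (commutatorElement_eq_one_iff_commute.mp this)).symm

theorem commute_conj_iff {a b g : H} : Commute a (g * b * g⁻¹) ↔ Commute (g⁻¹ * a * g) b := by
  constructor
  · intro h
    have := congrArg (fun t => g⁻¹ * t * g) h.eq
    show _ = _
    simpa [mul_assoc] using this
  · intro h
    have := congrArg (fun t => g * t * g⁻¹) h.eq
    show _ = _
    simpa [mul_assoc] using this

theorem commute_conj_inv_iff {a b g : H} : Commute a (g⁻¹ * b * g) ↔ Commute (g * a * g⁻¹) b := by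
  simpa using commute_conj_iff (a := a) (b := b) (g := g⁻¹)

theorem Commute.commutator_right {a b c : H} (h1 : Commute a b) (h2 : Commute a c) :
    Commute a ⁅b, c⁆ :=
  ((h1.mul_right h2).mul_right h1.inv_right).mul_right h2.inv_right

theorem commutator_mul_right_of_commute {a b c : H} (h : Commute a c) : ⁅a, b * c⁆ = ⁅a, b⁆ := by
  have h1 : c * a⁻¹ = a⁻¹ * c := h.inv_left.eq.symm
  calc ⁅a, b * c⁆ = a * b * (c * a⁻¹) * c⁻¹ * b⁻¹ := by rw [commutatorElement_def]; group
    _ = ⁅a, b⁆ := by rw [h1, commutatorElement_def]; group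

end GroupIdentities

/-! ### Consequences of the relations with at least three colours -/

section ThreeColours

variable {H κ ι : Type*} [Group H]

/-- The relations `[x_i, y_i]` and `[x_i, y_j z_j⁻¹]` (without restriction on `i` and `j`). -/
structure ColourRelations (X : κ → ι → H) : Prop where
  commute : ∀ {α β}, α ≠ β → ∀ i, Commute (X α i) (X β i)
  commute_div : ∀ {α β γ}, α ≠ β → α ≠ γ → β ≠ γ → ∀ i j, Commute (X α i) (X β j * (X γ j)⁻¹)

variable {X : κ → ι → H}

theorem ColourRelations.commute_inv_mul (h : ColourRelations X) {α β γ : κ} (hαβ : α ≠ β)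
    (hαγ : α ≠ γ) (hβγ : β ≠ γ) (i j : ι) : Commute (X α i) ((X β j)⁻¹ * X γ j) := by
  have := h.commute_div hαγ hαβ hβγ.symm i j
  rwa [((h.commute hβγ j).inv_left.eq : (X β j)⁻¹ * X γ j = X γ j * (X β j)⁻¹)]

theorem ColourRelations.conj_eq (h : ColourRelations X) {α β γ : κ} (hαβ : α ≠ β)
    (hαγ : α ≠ γ) (hβγ : β ≠ γ) (i j : ι) :
    X β j * X α i * (X β j)⁻¹ = X γ j * X α i * (X γ j)⁻¹ := by
  have := (h.commute_inv_mul hαγ hαβ hβγ.symm i j).eq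
  calc X β j * X α i * (X β j)⁻¹ = X γ j * ((X γ j)⁻¹ * X β j * X α i) * (X β j)⁻¹ := by group
    _ = X γ j * X α i * (X γ j)⁻¹ := by rw [← this]; group

/-- In `[y_l⁻¹, y_k⁻¹ z_k]` the letter `z_k` may be replaced by `x_k`, because `y_l` commutes with
`x_k⁻¹ z_k`. -/
theorem ColourRelations.commutator_eq (h : ColourRelations X) {α β γ : κ} (hαβ : α ≠ β)
    (hαγ : α ≠ γ) (hβγ : β ≠ γ) (l k : ι) :
    ⁅(X β l)⁻¹, (X β k)⁻¹ * X γ k⁆ = ⁅(X β l)⁻¹, (X β k)⁻¹ * X α k⁆ := by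
  rw [show (X β k)⁻¹ * X γ k = (X β k)⁻¹ * X α k * ((X α k)⁻¹ * X γ k) by group]
  exact commutator_mul_right_of_commute
    (h.commute_inv_mul hαβ.symm hβγ hαγ l k).inv_left

/-- With three colours, the letters of the first and the third colour commute with
`[y_l⁻¹, y_k⁻¹ z_k]`. The relators provide this for distinct indices; the degenerate cases
follow from the other relations. -/
theorem ColourRelations.commute_commutator (h : ColourRelations X) {α β γ : κ}
    (hαβ : α ≠ β) (hαγ : α ≠ γ) (hβγ : β ≠ γ)
    (h4 : ∀ {α β}, α ≠ β → ∀ {i j k}, i ≠ j → i ≠ k → j ≠ k →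
      Commute (X α i) ⁅(X β j)⁻¹, (X β k)⁻¹ * X α k⁆) (i l k : ι) :
    Commute (X α i) ⁅(X β l)⁻¹, (X β k)⁻¹ * X γ k⁆ := by
  by_cases hlk : l = k
  · subst hlk
    rw [commutatorElement_eq_one_iff_commute.mpr]
    · exact Commute.one_right _
    · exact (((Commute.refl (X β l)).inv_right).mul_right (h.commute hβγ l)).inv_left
  by_cases hil : i = l
  · subst hil
    exact (h.commute hαβ i).inv_right.commutator_right (h.commute_inv_mul hαβ hαγ hβγ i k)
  by_cases hik : i = k
  · subst hik
    have e : ⁅(X β l)⁻¹, (X β i)⁻¹ * X γ i⁆ = ((X β l)⁻¹ * X γ l) * (X β i)⁻¹ *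
        ((X β l)⁻¹ * X γ l)⁻¹ * X γ i * ((X β i)⁻¹ * X γ i)⁻¹ := by
      have e1 := (h.commute_inv_mul hαβ hαγ hβγ l i).eq
      have e2 := (h.commute_inv_mul hβγ.symm hαγ.symm hαβ.symm i l).eq
      have e3 := h.conj_eq hαβ.symm hβγ hαγ i l
      have e4 : X α l * (X β i)⁻¹ * (X α l)⁻¹ = X γ l * (X β i)⁻¹ * (X γ l)⁻¹ := by
        have := congrArg (·⁻¹) e3
        simpa [mul_assoc] using this
      calc ⁅(X β l)⁻¹, (X β i)⁻¹ * X γ i⁆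
          = (X β l)⁻¹ * (X α l * ((X β i)⁻¹ * X γ i) * (X α l)⁻¹) * X β l *
              ((X β i)⁻¹ * X γ i)⁻¹ := by
            rw [e1, commutatorElement_def]; group
        _ = (X β l)⁻¹ * (X α l * (X β i)⁻¹ * (X α l)⁻¹) * X β l *
              (((X β l)⁻¹ * X α l) * X γ i * ((X β l)⁻¹ * X α l)⁻¹) *
              ((X β i)⁻¹ * X γ i)⁻¹ := by group
        _ = _ := by rw [← e2, e4]; group
    rw [e]
    have c1 := h.commute_inv_mul hαβ hαγ hβγ i l
    have c2 := (h.commute hαβ i).inv_right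
    have c3 := h.commute hαγ i
    exact (((c1.mul_right c2).mul_right c1.inv_right).mul_right c3).mul_right
      (c2.mul_right c3).inv_right
  · rw [h.commutator_eq hαβ hαγ hβγ]
    exact h4 hαβ hil hik hlk

end ThreeColours

/-! ### Consequences of the relations with two colours -/

section TwoColours

variable {H ι : Type*} [Group H]

/-- The relations between the letters `x_i`, `y_i` of two colours, with `u_i = x_i y_i⁻¹`. -/
structure PairRelations (x y : ι → H) : Prop where
  commute : ∀ i, Commute (x i) (y i)
  swap : ∀ i j (ε δ : ℤˣ), ⁅x i ^ (ε : ℤ), y j ^ (δ : ℤ)⁆ = ⁅y i ^ (ε : ℤ), x j ^ (δ : ℤ)⁆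
  triple : ∀ {i j k} (ε δ : ℤˣ), i ≠ j → i ≠ k → j ≠ k →
    Commute (x i) ⁅y j ^ (ε : ℤ), (x k * (y k)⁻¹) ^ (δ : ℤ)⁆
  triple' : ∀ {i j k} (ε δ : ℤˣ), i ≠ j → i ≠ k → j ≠ k →
    Commute (y i) ⁅x j ^ (ε : ℤ), (x k * (y k)⁻¹) ^ (δ : ℤ)⁆
  quad : ∀ {i j k h} (δ τ : ℤˣ), i ≠ j → i ≠ k → i ≠ h → j ≠ k → j ≠ h → k ≠ h →
    Commute ⁅x i, (x k * (y k)⁻¹) ^ (δ : ℤ)⁆ ⁅y j, (x h * (y h)⁻¹) ^ (τ : ℤ)⁆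

/-- Three families `x_i = y_i u_i`, such as `a_i c_i⁻¹`, `b_i c_i⁻¹` and `a_i b_i⁻¹` in a product
of three free groups, with the relations between the commutators `[x_i, y_j]` in the third factor
and the commutators `[x_i, u_j]` in the first factor. -/
structure Triad (x y u : ι → H) : Prop where
  eq_mul : ∀ i, x i = y i * u i
  commute : ∀ i, Commute (y i) (u i)
  swap : ∀ i j, ⁅x i, y j⁆ = ⁅y i, x j⁆
  swap' : ∀ i j, ⁅x i, u j⁆ = ⁅u i, x j⁆
  comm : ∀ k i j, Commute (u k) ⁅x i, y j⁆
  comm' : ∀ k i j, Commute (y k) ⁅x i, u j⁆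
  comm_comm : ∀ i j k l, Commute ⁅x i, y j⁆ ⁅x k, u l⁆

theorem Triad.symm {x y u : ι → H} (h : Triad x y u) : Triad x u y where
  eq_mul i := by rw [h.eq_mul, (h.commute i).eq]
  commute i := (h.commute i).symm
  swap := h.swap'
  swap' := h.swap
  comm := h.comm'
  comm' := h.comm
  comm_comm i j k l := (h.comm_comm k l i j).symm

theorem coe_neg_units_zpow (g : H) (ε : ℤˣ) : g ^ ((-ε : ℤˣ) : ℤ) = (g ^ (ε : ℤ))⁻¹ := by
  rw [Units.val_neg, zpow_neg]

theorem PairRelations.symm {x y : ι → H} (h : PairRelations x y) : PairRelations y x where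
  commute i := (h.commute i).symm
  swap i j ε δ := (h.swap i j ε δ).symm
  triple {i j k} ε δ h1 h2 h3 := by
    have := h.triple' ε (-δ) h1 h2 h3
    rwa [coe_neg_units_zpow, ← inv_zpow, mul_inv_rev, inv_inv] at this
  triple' {i j k} ε δ h1 h2 h3 := by
    have := h.triple ε (-δ) h1 h2 h3
    rwa [coe_neg_units_zpow, ← inv_zpow, mul_inv_rev, inv_inv] at this
  quad {i j k l} δ τ h1 h2 h3 h4 h5 h6 := by
    have := h.quad (-τ) (-δ) h1.symm h5 h4 h3 h2 h6.symm
    simp only [coe_neg_units_zpow, ← inv_zpow, mul_inv_rev, inv_inv] at this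
    exact this.symm

namespace PairRelations

variable {x y : ι → H} (h : PairRelations x y)
include h

theorem div_zpow (k : ι) (δ : ℤ) : (x k * (y k)⁻¹) ^ δ = x k ^ δ * (y k ^ δ)⁻¹ := by
  rw [(h.commute k).inv_right.mul_zpow, inv_zpow]

/-- The swap relation for the letters `x` and `u = x y⁻¹`. -/
theorem swap_div (i j : ι) (ε δ : ℤˣ) :
    ⁅x i ^ (ε : ℤ), (x j * (y j)⁻¹) ^ (δ : ℤ)⁆ = ⁅(x i * (y i)⁻¹) ^ (ε : ℤ), x j ^ (δ : ℤ)⁆ := by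
  have h1 := h.swap j i (-δ) (-ε)
  simp only [coe_neg_units_zpow] at h1
  rw [h.div_zpow, h.div_zpow]
  generalize x i ^ (ε : ℤ) = a at *
  generalize y i ^ (ε : ℤ) = b at *
  generalize x j ^ (δ : ℤ) = a' at *
  generalize y j ^ (δ : ℤ) = b' at *
  have h2 : a' * ⁅a'⁻¹, b⁻¹⁆ = a' * ⁅b'⁻¹, a⁻¹⁆ := by rw [h1]
  calc ⁅a, a' * b'⁻¹⁆ = a * (a' * ⁅b'⁻¹, a⁻¹⁆) * a⁻¹ * a'⁻¹ := by
        simp only [commutatorElement_def]; group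
    _ = _ := by rw [← h2]; simp only [commutatorElement_def]; group

theorem commute_div_of_eq (i j : ι) (ε δ : ℤˣ) :
    Commute (x j * (y j)⁻¹) ⁅x i ^ (ε : ℤ), y j ^ (δ : ℤ)⁆ := by
  have h1 := h.swap i j ε δ
  have h2 := h.swap i j ε (-δ)
  simp only [coe_neg_units_zpow] at h2
  have h3 := commute_commutator_of_swap h1 h2
  rw [← h.div_zpow] at h3
  rcases Int.units_eq_one_or δ with rfl | rfl
  · simpa using h3
  · simpa using h3.inv_left

/-- The elements `u_k` commute with the commutators `[x_i, y_j]`. If `k` is one of `i` and `j`, this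
follows from the swap relations; otherwise it is the Hall–Witt identity applied to the relations
`triple` and `triple'`. -/
theorem commute_div (k i j : ι) : Commute (x k * (y k)⁻¹) ⁅x i, y j⁆ := by
  by_cases hij : i = j
  · subst hij
    rw [commutatorElement_eq_one_iff_commute.mpr (h.commute i)]
    exact Commute.one_right _
  by_cases hkj : k = j
  · subst hkj
    simpa using h.commute_div_of_eq i k 1 1
  by_cases hki : k = i
  · subst hki
    have := (h.commute_div_of_eq j k 1 1).inv_right
    rw [commutatorElement_inv] at this
    have h2 := h.swap k j 1 1
    simp only [Units.val_one, zpow_one] at this h2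
    rwa [h2]
  · have h1 := h.triple (-1) (-1) (Ne.symm (Ne.symm hij)) (Ne.symm hki) (Ne.symm hkj)
    have h2 := h.triple' (-1) 1 (Ne.symm hij) (Ne.symm hkj) (Ne.symm hki)
    apply commute_commutator_of_hallWitt
    · simpa using h1.symm
    · simpa using (h2.inv_right).symm

theorem commute_commutator_div (k i j : ι) (ε δ : ℤˣ) :
    Commute (y k) ⁅x i ^ (ε : ℤ), (x j * (y j)⁻¹) ^ (δ : ℤ)⁆ := by
  have aux : ∀ i j (ε δ : ℤˣ),
      Commute (y j) ⁅x i ^ (ε : ℤ), (x j * (y j)⁻¹) ^ (δ : ℤ)⁆ := by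
    intro i j ε δ
    have h1 := h.swap_div i j ε δ
    have h2 := h.swap_div i j ε (-δ)
    simp only [coe_neg_units_zpow] at h2
    have h3 := commute_commutator_of_swap h1 h2
    have h4 : x j ^ (δ : ℤ) * ((x j * (y j)⁻¹) ^ (δ : ℤ))⁻¹ = y j ^ (δ : ℤ) := by
      rw [h.div_zpow, mul_inv_rev, inv_inv, ← mul_assoc, ((h.commute j).zpow_zpow δ δ).eq,
        mul_inv_cancel_right]
    rw [h4] at h3
    rcases Int.units_eq_one_or δ with rfl | rfl
    · simpa using h3
    · simpa using h3.inv_left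
  by_cases hkj : k = j
  · subst hkj; exact aux i k ε δ
  by_cases hki : k = i
  · subst hki
    rw [h.swap_div, ← commutatorElement_inv]
    exact (aux j k δ ε).inv_right
  by_cases hij : i = j
  · subst hij
    have : Commute (x i ^ (ε : ℤ)) ((x i * (y i)⁻¹) ^ (δ : ℤ)) :=
      ((Commute.refl (x i)).mul_right (h.commute i).inv_right).zpow_zpow _ _
    rw [commutatorElement_eq_one_iff_commute.mpr this]
    exact Commute.one_right _
  · exact h.triple' ε δ hki hkj hij

theorem commute_commutator_div' (k i j : ι) (ε δ : ℤˣ) :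
    Commute (x k) ⁅y i ^ (ε : ℤ), (x j * (y j)⁻¹) ^ (δ : ℤ)⁆ := by
  have := h.symm.commute_commutator_div k i j ε (-δ)
  rwa [coe_neg_units_zpow, ← inv_zpow, mul_inv_rev, inv_inv] at this

theorem commute_commutator_aux (k l j : ι) (ε : ℤˣ) :
    Commute ⁅x k, x l * (y l)⁻¹⁆ ⁅y j ^ (ε : ℤ), x l * (y l)⁻¹⁆ := by
  have h1 := h.commute_commutator_div' k j l ε 1
  have h2 := h.commute_commutator_div' k j l ε (-1)
  simp only [Units.val_one, zpow_one, Units.val_neg, zpow_neg] at h1 h2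
  generalize x l * (y l)⁻¹ = u at *
  have h3 : Commute (u * (x k)⁻¹ * u⁻¹) ⁅y j ^ (ε : ℤ), u⁆ := by
    rw [← commute_conj_inv_iff]
    have : u⁻¹ * ⁅y j ^ (ε : ℤ), u⁆ * u = ⁅y j ^ (ε : ℤ), u⁻¹⁆⁻¹ := by
      simp only [commutatorElement_def]; group
    rw [this]
    exact h2.inv_inv
  rw [show ⁅x k, u⁆ = x k * (u * (x k)⁻¹ * u⁻¹) by rw [commutatorElement_def]; group]
  exact h1.mul_left h3

theorem commute_commutator_aux' (k l j : ι) :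
    Commute ⁅x k, x l * (y l)⁻¹⁆ ⁅(y j)⁻¹, (x l * (y l)⁻¹)⁻¹⁆ := by
  have h1 := h.commute_commutator_aux k l j (-1)
  have h2 := h.commute_commutator_div' l j l (-1) 1
  have h3 := h.commute_commutator_div l k l 1 1
  simp only [Units.val_one, zpow_one, Units.val_neg, zpow_neg] at h1 h2 h3
  have h4 : ⁅(y j)⁻¹, (x l * (y l)⁻¹)⁻¹⁆ = y l * ⁅(y j)⁻¹, x l * (y l)⁻¹⁆⁻¹ * (y l)⁻¹ := by
    have e : ⁅(y j)⁻¹, (x l * (y l)⁻¹)⁻¹⁆ =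
        y l * ((x l)⁻¹ * ⁅(y j)⁻¹, x l * (y l)⁻¹⁆⁻¹ * x l) * (y l)⁻¹ := by
      simp only [commutatorElement_def]; group
    rw [e, mul_assoc (x l)⁻¹, ← h2.inv_right.eq, inv_mul_cancel_left]
  rw [h4]
  exact (h3.symm.mul_right h1.inv_right).mul_right h3.symm.inv_right

/-- The relation `quad` without the restriction that the indices are distinct. -/
theorem commute_commutator_commutator (k l j i : ι) :
    Commute ⁅x k, x l * (y l)⁻¹⁆ ⁅y j, x i * (y i)⁻¹⁆ := by
  have sx : ∀ k l, ⁅x k, x l * (y l)⁻¹⁆ = ⁅x l, x k * (y k)⁻¹⁆⁻¹ := by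
    intro k l
    have := h.swap_div k l 1 1
    simp only [Units.val_one, zpow_one] at this
    rw [this, commutatorElement_inv]
  have sy : ∀ j i, ⁅y j, x i * (y i)⁻¹⁆ = ⁅(y i)⁻¹, (x j * (y j)⁻¹)⁻¹⁆⁻¹ := by
    intro j i
    have := h.symm.swap_div i j (-1) 1
    simp only [Units.val_one, zpow_one, Units.val_neg, zpow_neg, mul_inv_rev, inv_inv] at this
    rw [mul_inv_rev, inv_inv, this, commutatorElement_inv]
  by_cases hil : i = l
  · subst hil
    simpa using h.commute_commutator_aux k i j 1
  by_cases hik : i = k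
  · subst hik
    rw [sx]
    simpa using (h.commute_commutator_aux l i j 1).inv_left
  by_cases hjl : j = l
  · subst hjl
    rw [sy]
    exact (h.commute_commutator_aux' k j i).inv_right
  by_cases hjk : j = k
  · subst hjk
    rw [sy, sx]
    exact (h.commute_commutator_aux' l j i).inv_inv
  by_cases hkl : k = l
  · subst hkl
    rw [commutatorElement_eq_one_iff_commute.mpr
      ((Commute.refl (x k)).mul_right (h.commute k).inv_right)]
    exact Commute.one_left _
  by_cases hij : i = j
  · subst hij
    rw [commutatorElement_eq_one_iff_commute.mpr
      ((h.commute i).symm.mul_right (Commute.refl (y i)).inv_right)]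
    exact Commute.one_right _
  · simpa using h.quad 1 1 (Ne.symm hjk) hkl (Ne.symm hik) hjl (Ne.symm hij) (Ne.symm hil)

/-- The commutators `[x_i, y_j]` and `[x_k, u_l]` commute because `x_i` conjugates `y_j` to
`y_i [y_j, u_i]⁻¹ y_j y_i⁻¹`, all of whose factors commute with `[x_k, u_l]`. -/
theorem triad : Triad x y (fun i => x i * (y i)⁻¹) where
  eq_mul i := by rw [← mul_assoc, ← (h.commute i).eq, mul_inv_cancel_right]
  commute i := (h.commute i).symm.mul_right (Commute.refl (y i)).inv_right
  swap i j := by simpa using h.swap i j 1 1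
  swap' i j := by simpa using h.swap_div i j 1 1
  comm := h.commute_div
  comm' k i j := by simpa using h.commute_commutator_div k i j 1 1
  comm_comm i j k l := by
    have c : ∀ m, Commute (y m) ⁅x k, x l * (y l)⁻¹⁆ := fun m => by
      simpa using h.commute_commutator_div m k l 1 1
    have h1 := h.commute_commutator_commutator k l j i
    have h2 : Commute (x i * y j * (x i)⁻¹) ⁅x k, x l * (y l)⁻¹⁆ := by
      have e : x i * y j * (x i)⁻¹ =
          y i * (⁅y j, x i * (y i)⁻¹⁆⁻¹ * y j) * (y i)⁻¹ := by
        have hc := (h.commute i).eq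
        have e1 : x i = y i * (x i * (y i)⁻¹) := by
          rw [← mul_assoc, ← hc, mul_inv_cancel_right]
        conv_lhs => rw [e1]
        simp only [commutatorElement_def]; group
      rw [e]
      exact ((c i).mul_left (h1.symm.inv_left.mul_left (c j))).mul_left (c i).inv_left
    exact h2.mul_left (c j).inv_left

end PairRelations

end TwoColours

/-! ### Products of boundedly many powers -/

section Products

variable {S T : Type*} {R : Set (FreeGroup S)} {N : T → ℕ}

namespace Comm

variable {d : ℕ} {f g h : T → FreeGroup S}

theorem mul_right (h1 : Comm R N d f g) (h2 : Comm R N d f h) : Comm R N d f (g * h) := by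
  rw [Comm, map_mul]; exact Commute.mul_right h1 h2

theorem mul_left (h1 : Comm R N d f h) (h2 : Comm R N d g h) : Comm R N d (f * g) h := by
  rw [Comm, map_mul]; exact Commute.mul_left h1 h2

theorem inv_right (h1 : Comm R N d f g) : Comm R N d f g⁻¹ := by
  rw [Comm, map_inv]; exact Commute.inv_right h1

theorem inv_left (h1 : Comm R N d f g) : Comm R N d f⁻¹ g := by
  rw [Comm, map_inv]; exact Commute.inv_left h1

theorem congr_right (h1 : Comm R N d f g) (h2 : Cong R N d g h) : Comm R N d f h := by
  rw [Comm, ← h2]; exact h1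

theorem congr_left (h1 : Comm R N d f g) (h2 : Cong R N d f h) : Comm R N d h g := by
  rw [Comm, ← h2]; exact h1

theorem conj_iff : Comm R N d f (h * g * h⁻¹) ↔ Comm R N d (h⁻¹ * f * h) g := by
  simp only [Comm, map_mul, map_inv]; exact commute_conj_iff

theorem conj_inv_iff : Comm R N d f (h⁻¹ * g * h) ↔ Comm R N d (h * f * h⁻¹) g := by
  simp only [Comm, map_mul, map_inv]; exact commute_conj_inv_iff

/-- Conjugation by `f` and by `g` agree on what commutes with `f⁻¹ * g`. -/
theorem conj_cong (h1 : Comm R N d (f⁻¹ * g) h) :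
    Cong R N d (f * h * f⁻¹) (g * h * g⁻¹) := by
  have := h1.eq
  simp only [Cong, map_mul, map_inv] at *
  have h2 := congrArg (fun t => cls R N d f * t * (cls R N d g)⁻¹) this
  simp only [mul_assoc, mul_inv_cancel_left, mul_inv_cancel, mul_one] at h2
  simp only [mul_assoc]
  exact h2.symm

theorem of_conj_cong (h1 : Cong R N d (f * h * f⁻¹) (g * h * g⁻¹)) :
    Comm R N d (f⁻¹ * g) h := by
  simp only [Cong, map_mul, map_inv] at h1
  simp only [Comm, map_mul, map_inv]
  have h2 := congrArg (fun t => (cls R N d f)⁻¹ * t * (cls R N d g)) h1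
  simp only [mul_assoc, inv_mul_cancel_left, inv_mul_cancel, mul_one] at h2
  show _ = _
  simp only [mul_assoc]
  exact h2.symm

end Comm

namespace Cong

variable {d : ℕ} {f g f' g' : T → FreeGroup S}

theorem refl (f : T → FreeGroup S) : Cong R N d f f := rfl

theorem mul (h1 : Cong R N d f g) (h2 : Cong R N d f' g') : Cong R N d (f * f') (g * g') := by
  simp only [Cong, map_mul] at *; rw [h1, h2]

theorem inv (h1 : Cong R N d f g) : Cong R N d f⁻¹ g⁻¹ := by
  simp only [Cong, map_inv] at *; rw [h1]

theorem conj (h1 : Cong R N d f g) (h2 : Cong R N d f' g') :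
    Cong R N d (f * f' * f⁻¹) (g * g' * g⁻¹) := (h1.mul h2).mul h1.inv

end Cong

theorem comm_vpow_vpow {f g : T → FreeGroup S} (h : Comm R N 0 f g) {e e' : T → ℤ}
    (he : Bounded N e) (he' : Bounded N e') : Comm R N 2 (vpow f e) (vpow g e') :=
  (h.vpow_left he).vpow_right he'

theorem vpow_inv_mul {f g : T → FreeGroup S} (h : Comm R N 0 f g) {e : T → ℤ}
    (he : Bounded N e) : Cong R N 2 (vpow (f⁻¹ * g) e) ((vpow f e)⁻¹ * vpow g e) := by
  have := h.inv_left.mul_vpow he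
  rwa [vpow_inv] at this

variable {ι : Type*}

/-- The product of the powers `x_i ^ e` over a list of pairs `(i, e)`. -/
def powProd (x : ι → T → FreeGroup S) (w : List (ι × (T → ℤ))) : T → FreeGroup S :=
  (w.map fun p => vpow (x p.1) p.2).prod

/-- All exponents in the list are bounded by the size function. -/
def BoundedList (N : T → ℕ) (w : List (ι × (T → ℤ))) : Prop := ∀ p ∈ w, Bounded N p.2

@[simp] theorem powProd_nil (x : ι → T → FreeGroup S) : powProd x [] = 1 := rfl

@[simp] theorem powProd_cons (x : ι → T → FreeGroup S) (p : ι × (T → ℤ)) (w : List (ι × (T → ℤ))) :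
    powProd x (p :: w) = vpow (x p.1) p.2 * powProd x w := by simp [powProd]

@[simp] theorem powProd_append (x : ι → T → FreeGroup S) (v w : List (ι × (T → ℤ))) :
    powProd x (v ++ w) = powProd x v * powProd x w := by simp [powProd]

/-- The list for the inverse of a product of powers. -/
def invList (w : List (ι × (T → ℤ))) : List (ι × (T → ℤ)) := (w.map fun p => (p.1, -p.2)).reverse

theorem powProd_invList (x : ι → T → FreeGroup S) (w : List (ι × (T → ℤ))) :
    powProd x (invList w) = (powProd x w)⁻¹ := by
  induction w with
  | nil => simp [invList]
  | cons p w ih =>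
    have : invList (p :: w) = invList w ++ [(p.1, -p.2)] := by simp [invList]
    rw [this, powProd_append, ih]
    simp [vpow_neg]

theorem BoundedList.invList {w : List (ι × (T → ℤ))} (h : BoundedList N w) :
    BoundedList N (invList w) := by
  intro p hp
  simp only [_root_.invList, List.mem_reverse, List.mem_map] at hp
  obtain ⟨q, hq, rfl⟩ := hp
  exact (h q hq).neg

theorem BoundedList.append {v w : List (ι × (T → ℤ))} (h : BoundedList N v)
    (h' : BoundedList N w) : BoundedList N (v ++ w) := fun p hp =>
  (List.mem_append.mp hp).elim (h p) (h' p)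

theorem BoundedList.cons {p : ι × (T → ℤ)} {w : List (ι × (T → ℤ))} (h : Bounded N p.2)
    (h' : BoundedList N w) : BoundedList N (p :: w) := by
  intro q hq
  rcases List.mem_cons.mp hq with rfl | hq
  exacts [h, h' q hq]

theorem boundedList_cons {p : ι × (T → ℤ)} {w : List (ι × (T → ℤ))} :
    BoundedList N (p :: w) ↔ Bounded N p.2 ∧ BoundedList N w := by
  simp [BoundedList]

theorem boundedList_append {v w : List (ι × (T → ℤ))} :
    BoundedList N (v ++ w) ↔ BoundedList N v ∧ BoundedList N w := by
  simp [BoundedList, or_imp, forall_and]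

theorem boundedList_nil : BoundedList N ([] : List (ι × (T → ℤ))) := by simp [BoundedList]

theorem Comm.powProd_right {d : ℕ} {f : T → FreeGroup S} {x : ι → T → FreeGroup S}
    (h : ∀ i, Comm R N d f (x i)) {w : List (ι × (T → ℤ))} (hw : BoundedList N w) :
    Comm R N (d + 1) f (powProd x w) := by
  induction w with
  | nil => rw [powProd_nil, Comm, map_one]; exact Commute.one_right _
  | cons p w ih =>
    rw [boundedList_cons] at hw
    rw [powProd_cons]
    exact ((h p.1).vpow_right hw.1).mul_right (ih hw.2)

/-- What the pushing argument needs to know about words in the kernel: let `x`, `y` be the letters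
of two colours and `v`, `w` products of boundedly many bounded powers. Conjugating a letter `x_j`
by `w` does not depend on the colour of `w` as long as it is not that of `x_j`; the commutator
`[w, x_j]` does not change when the two colours are exchanged; the elements
`[v(x)⁻¹ v(y), x_i]`, which only involve the factor that belongs to `x`, commute with the conjugates
`w(x) y_j w(x)⁻¹`. All of this holds up to area `O(N ^ d)`. -/
structure PushRelations {κ : Type*} (R : Set (FreeGroup S)) (N : T → ℕ) (d : ℕ)
    (X : κ → ι → T → FreeGroup S) : Prop where
  commute : ∀ {α β}, α ≠ β → ∀ i, Comm R N d (X α i) (X β i)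
  recolour : ∀ {α β γ}, α ≠ β → α ≠ γ → ∀ j {w}, BoundedList N w →
    Cong R N d (powProd (X β) w * X α j * (powProd (X β) w)⁻¹)
      (powProd (X γ) w * X α j * (powProd (X γ) w)⁻¹)
  swap : ∀ {α β}, α ≠ β → ∀ j {w}, BoundedList N w →
    Cong R N d ⁅powProd (X β) w, X α j⁆ ⁅powProd (X α) w, X β j⁆
  comm : ∀ {α β}, α ≠ β → ∀ i j {v w}, BoundedList N v → BoundedList N w →
    Comm R N d ⁅(powProd (X α) v)⁻¹ * powProd (X β) v, X α i⁆
      (powProd (X α) w * X β j * (powProd (X α) w)⁻¹)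

variable {κ : Type*} {X : κ → ι → T → FreeGroup S}

/-- With at least three colours, the invariance of `w x_j w⁻¹` under a change of the colour of `w`
implies the other relations, by passing through a third colour. -/
theorem pushRelations_of_recolour {d : ℕ} (hd : 1 ≤ d)
    (h : ColourRelations fun α i => cls R N 0 (X α i))
    (h3 : ∀ α β : κ, ∃ γ, γ ≠ α ∧ γ ≠ β)
    (hrec : ∀ {α β γ}, α ≠ β → α ≠ γ → β ≠ γ → ∀ j {w}, BoundedList N w →
      Comm R N d (X α j) ((powProd (X β) w)⁻¹ * powProd (X γ) w)) :
    PushRelations R N d X := by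
  have hcongr : ∀ {α β γ}, α ≠ β → α ≠ γ → ∀ j {w}, BoundedList N w →
    Cong R N d (powProd (X β) w * X α j * (powProd (X β) w)⁻¹)
      (powProd (X γ) w * X α j * (powProd (X γ) w)⁻¹) := by
    intro α β γ h1 h2 j w hw
    by_cases h3 : β = γ
    · subst h3; rfl
    · exact Comm.conj_cong (hrec h1 h2 h3 j hw).symm
  refine ⟨fun h1 i => ?_, hcongr, ?_, ?_⟩
  · have h0 : Comm R N 0 (X _ i) (X _ i) := h.commute h1 i
    exact h0.mono (Nat.zero_le _)
  · intro α β hαβ j w hw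
    obtain ⟨γ, hγα, hγβ⟩ := h3 α β
    have e1 : Cong R N d ⁅powProd (X β) w, X α j⁆ ⁅powProd (X γ) w, X α j⁆ :=
      (hcongr hαβ hγα.symm j hw).mul (Cong.refl _)
    have e2 : Cong R N d ⁅powProd (X α) w, X β j⁆ ⁅powProd (X γ) w, X β j⁆ :=
      (hcongr hαβ.symm hγβ.symm j hw).mul (Cong.refl _)
    refine e1.trans (Eq.trans ?_ e2.symm)
    have e3 : Comm R N d ((X α j)⁻¹ * X β j) (powProd (X γ) w) :=
      (Comm.powProd_right (fun i => by
        have := (h.commute_inv_mul hγα hγβ hαβ i j).symm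
        rwa [← map_inv, ← map_mul] at this) hw).mono (by omega)
    have e4 := e3.inv_right.eq
    simp only [commutatorElement_def, map_mul, map_inv] at e4 ⊢
    generalize cls R N d (powProd (X γ) w) = W at *
    generalize cls R N d (X α j) = a at *
    generalize cls R N d (X β j) = b at *
    calc W * a * W⁻¹ * a⁻¹ = W * a * (W⁻¹ * (a⁻¹ * b)) * b⁻¹ := by group
      _ = W * b * W⁻¹ * b⁻¹ := by rw [← e4]; group
  · intro α β hαβ i j v w hv hw
    obtain ⟨γ, hγα, hγβ⟩ := h3 α β
    have key : ∀ {w}, BoundedList N w → Comm R N d ((powProd (X α) v)⁻¹ * powProd (X γ) v)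
        (powProd (X α) w * X β j * (powProd (X α) w)⁻¹) := by
      intro w hw
      apply Comm.of_conj_cong
      have e1 := hcongr hαβ.symm hγβ.symm j (hv.append hw)
      have e2 := hcongr hαβ.symm hγβ.symm j hw
      have e3 := (Cong.refl (powProd (X γ) v)).conj e2
      have e4 : ∀ {δ}, powProd (X δ) (v ++ w) * X β j * (powProd (X δ) (v ++ w))⁻¹ =
          powProd (X δ) v * (powProd (X δ) w * X β j * (powProd (X δ) w)⁻¹) *
            (powProd (X δ) v)⁻¹ := by
        simp only [powProd_append, mul_inv_rev, mul_assoc, implies_true]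
      rw [e4, e4] at e1
      exact e1.trans e3.symm
    have e1 : Cong R N d ⁅(powProd (X α) v)⁻¹ * powProd (X γ) v, X α i⁆
        ⁅(powProd (X α) v)⁻¹ * powProd (X β) v, X α i⁆ := by
      have := (hcongr hγα.symm hαβ i hv)
      have := (((Cong.refl (powProd (X α) v)⁻¹).conj this)).mul
        (Cong.refl (X α i)⁻¹)
      convert this using 2 <;> simp only [commutatorElement_def] <;> group
    refine Comm.congr_left ?_ e1
    have h1 : Comm R N d ((powProd (X α) v)⁻¹ * powProd (X γ) v)
        ((X α i)⁻¹ * (powProd (X α) w * X β j * (powProd (X α) w)⁻¹) * X α i) := by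
      have := key (w := (i, -1) :: w) (hw.cons bounded_one.neg)
      simpa only [powProd_cons, vpow_neg, vpow_one, mul_inv_rev, inv_inv, mul_assoc] using this
    rw [Comm.conj_inv_iff] at h1
    have h2 := (key hw).mul_left h1.inv_left
    convert h2 using 2
    rw [commutatorElement_def]; group

/-- Five factors or more: a fourth colour is available, and each step of the induction over the
product of powers costs only quadratic area. -/
theorem comm_vpow_of_four_colours (h : ColourRelations fun α i => cls R N 0 (X α i))
    (h4 : ∀ α β γ : κ, ∃ δ, δ ≠ α ∧ δ ≠ β ∧ δ ≠ γ) {w : List (ι × (T → ℤ))}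
    (hw : BoundedList N w) {α β γ : κ} (hαβ : α ≠ β) (hαγ : α ≠ γ) (hβγ : β ≠ γ) (j : ι)
    {s : T → ℤ} (hs : Bounded N s) :
    Comm R N 2 (vpow (X α j) s) ((powProd (X β) w)⁻¹ * powProd (X γ) w) := by
  have base : ∀ {α β γ : κ} (_ : α ≠ β) (_ : α ≠ γ) (_ : β ≠ γ) (i j : ι) {s e : T → ℤ}
      (_ : Bounded N s) (_ : Bounded N e),
      Comm R N 2 (vpow (X α j) s) ((vpow (X β i) e)⁻¹ * vpow (X γ i) e) := by
    intro α β γ h1 h2 h3 i j s e hs he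
    have c0 : Comm R N 0 (X β i) (X γ i) := h.commute h3 i
    have c1 : Comm R N 0 (X α j) ((X β i)⁻¹ * X γ i) := by
      have := h.commute_inv_mul h1 h2 h3 j i
      rwa [← map_inv, ← map_mul] at this
    exact (comm_vpow_vpow c1 hs he).congr_right (vpow_inv_mul c0 he)
  induction w using List.reverseRecOn generalizing α β γ j s with
  | nil => simp only [powProd_nil, inv_one, mul_one, Comm, map_one]; exact Commute.one_right _
  | append_singleton w p ih =>
    obtain ⟨hw, hp⟩ := boundedList_append.mp hw
    have hp := hp p (by simp)
    obtain ⟨δ, hδα, hδβ, hδγ⟩ := h4 α β γ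
    have e1 : Cong R N 2
        (((vpow (X β p.1) p.2)⁻¹ * vpow (X δ p.1) p.2) *
          ((powProd (X β) w)⁻¹ * powProd (X γ) w) *
          ((vpow (X δ p.1) p.2)⁻¹ * vpow (X γ p.1) p.2))
        ((powProd (X β) (w ++ [p]))⁻¹ * powProd (X γ) (w ++ [p])) := by
      have := (ih hw hδβ hδγ hβγ p.1 hp).eq
      simp only [Cong, powProd_append, powProd_cons, powProd_nil, mul_one, map_mul, map_inv,
        mul_inv_rev] at this ⊢
      generalize cls R N 2 (powProd (X β) w) = B at *
      generalize cls R N 2 (powProd (X γ) w) = C at *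
      generalize cls R N 2 (vpow (X δ p.1) p.2) = D at *
      generalize cls R N 2 (vpow (X β p.1) p.2) = b at *
      generalize cls R N 2 (vpow (X γ p.1) p.2) = c at *
      calc b⁻¹ * D * (B⁻¹ * C) * (D⁻¹ * c) = b⁻¹ * (D * (B⁻¹ * C)) * D⁻¹ * c := by group
        _ = _ := by rw [this]; group
    refine Comm.congr_right ?_ e1
    exact ((base hαβ hδα.symm hδβ.symm _ _ hs hp).mul_right (ih hw hαβ hαγ hβγ j hs)).mul_right
      (base hδα.symm hαγ hδγ _ _ hs hp)

/-- Four factors: the commutators `[y(w)⁻¹, y_k⁻¹ z_k]` commute with all powers of letters of the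
two colours other than that of `y`. -/
theorem comm_vpow_commutator_of_three_colours
    (h : ColourRelations fun α i => cls R N 0 (X α i))
    (h4 : ∀ {α β γ}, α ≠ β → α ≠ γ → β ≠ γ → ∀ i l k,
      Comm R N 0 (X α i) ⁅(X β l)⁻¹, (X β k)⁻¹ * X γ k⁆) {w : List (ι × (T → ℤ))}
    (hw : BoundedList N w) {α β γ δ : κ} (hαβ : α ≠ β) (hαγ : α ≠ γ) (hβγ : β ≠ γ)
    (hδ : δ = α ∨ δ = γ) (k j : ι) {s : T → ℤ} (hs : Bounded N s) :
    Comm R N 2 (vpow (X δ j) s) ⁅(powProd (X β) w)⁻¹, (X β k)⁻¹ * X γ k⁆ := by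
  have hu : ∀ {α β γ}, α ≠ β → α ≠ γ → β ≠ γ → ∀ i l,
      Comm R N 0 (X α i) ((X β l)⁻¹ * X γ l) := by
    intro α β γ h1 h2 h3 i l
    have := h.commute_inv_mul h1 h2 h3 i l
    rwa [← map_inv, ← map_mul] at this
  have hc : ∀ {α β}, α ≠ β → ∀ i, Comm R N 0 (X α i) (X β i) := fun h1 i => h.commute h1 i
  -- the commutator commutes with letters of the third colour, which is either of the other two
  have h4' : ∀ {α β γ}, α ≠ β → α ≠ γ → β ≠ γ → ∀ i l k,
      Comm R N 0 (X γ i) ⁅(X β l)⁻¹, (X β k)⁻¹ * X γ k⁆ := by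
    intro α β γ h1 h2 h3 i l k
    have := h4 h3.symm h2.symm h1.symm i l k
    refine this.congr_right ?_
    have e := h.commutator_eq h3.symm h2.symm h1.symm l k
    simpa only [Cong, commutatorElement_def, map_mul, map_inv] using e
  -- a power of a single letter: the target has colour `δ`, the letter `y_l` is compared with
  -- the letter of the remaining colour `ε`
  have base : ∀ {δ ε}, δ ≠ β → δ ≠ ε → β ≠ ε →
      (∀ i l k, Comm R N 0 (X δ i) ⁅(X β l)⁻¹, (X β k)⁻¹ * X γ k⁆) →
      (∀ i l k, Comm R N 0 (X ε i) ⁅(X β l)⁻¹, (X β k)⁻¹ * X γ k⁆) →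
      ∀ j l {e s : T → ℤ}, Bounded N e → Bounded N s →
      Comm R N 2 (vpow (X δ j) s) ⁅(vpow (X β l) e)⁻¹, (X β k)⁻¹ * X γ k⁆ := by
    intro δ ε h1 h2 h3 hδ hε j l e s he hs
    set c := ⁅(X β l)⁻¹, (X β k)⁻¹ * X γ k⁆ with hcdef
    set u := (X β l)⁻¹ * X ε l with hudef
    have e1 : ⁅(vpow (X β l) e)⁻¹, (X β k)⁻¹ * X γ k⁆ =
        (vpow (X β l) e)⁻¹ * vpow (X β l * c) e := by
      have : X β l * c = ((X β k)⁻¹ * X γ k) * X β l * ((X β k)⁻¹ * X γ k)⁻¹ := by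
        rw [hcdef, commutatorElement_def]; group
      rw [this, conj_vpow, commutatorElement_def]; group
    have hεu : Comm R N 0 (X ε l) (u⁻¹) :=
      ((hc h3.symm l).inv_right.mul_right (Commute.refl _ : Comm R N 0 _ _)).inv_right
    have e2 : Cong R N 2 (vpow (X β l * c) e) (vpow (X ε l) e * vpow (u⁻¹ * c) e) := by
      have : X β l * c = X ε l * (u⁻¹ * c) := by rw [hudef]; group
      rw [this]
      exact (hεu.mul_right (hε l l k)).mul_vpow he
    have e3 : Cong R N 2 ((vpow (X β l) e)⁻¹ * vpow (X β l * c) e)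
        (vpow u e * vpow (u⁻¹ * c) e) := by
      have := vpow_inv_mul (hc h3 l) he
      refine ((Cong.refl _).mul e2).trans ?_
      rw [← mul_assoc]
      exact Cong.mul this.symm (Cong.refl _)
    rw [e1]
    refine Comm.congr_right ?_ e3.symm
    have hδu := hu h1 h2 h3 j l
    exact (comm_vpow_vpow hδu hs he).mul_right
      (comm_vpow_vpow (hδu.inv_right.mul_right (hδ j l k)) hs he)
  induction w using List.reverseRecOn generalizing δ j s with
  | nil =>
    simp only [powProd_nil, inv_one, commutatorElement_one_left, Comm, map_one]
    exact Commute.one_right _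
  | append_singleton w p ih =>
    obtain ⟨hw, hp⟩ := boundedList_append.mp hw
    have hp := hp p (by simp)
    obtain ⟨ε, hε, hδε⟩ : ∃ ε, (ε = α ∨ ε = γ) ∧ δ ≠ ε := by
      rcases hδ with rfl | rfl
      exacts [⟨γ, Or.inr rfl, hαγ⟩, ⟨α, Or.inl rfl, hαγ.symm⟩]
    have ne : ∀ {δ}, δ = α ∨ δ = γ → δ ≠ β := by
      rintro δ (rfl | rfl)
      exacts [hαβ, hβγ.symm]
    have hcomm : ∀ {δ}, δ = α ∨ δ = γ →
        ∀ i l k, Comm R N 0 (X δ i) ⁅(X β l)⁻¹, (X β k)⁻¹ * X γ k⁆ := by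
      rintro δ (rfl | rfl)
      exacts [h4 hαβ hαγ hβγ, h4' hαβ hαγ hβγ]
    have h1 := base (ne hδ) hδε (ne hε).symm (hcomm hδ) (hcomm hε) j p.1 hp hs
    have e1 : ⁅(powProd (X β) (w ++ [p]))⁻¹, (X β k)⁻¹ * X γ k⁆ =
        (vpow (X β p.1) p.2)⁻¹ * ⁅(powProd (X β) w)⁻¹, (X β k)⁻¹ * X γ k⁆ * vpow (X β p.1) p.2 *
          ⁅(vpow (X β p.1) p.2)⁻¹, (X β k)⁻¹ * X γ k⁆ := by
      simp only [powProd_append, powProd_cons, powProd_nil, commutatorElement_def]; group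
    rw [e1]
    refine Comm.mul_right ?_ h1
    -- conjugation by `y_l ^ (-e)` agrees with conjugation by `y_l ^ (-e) t_l ^ e`, for the
    -- letter `t_l` of the remaining colour
    have h2 := ih hw hε p.1 hp
    have h3 : Comm R N 2 (vpow (X δ j) s) ((vpow (X β p.1) p.2)⁻¹ * vpow (X ε p.1) p.2) :=
      (comm_vpow_vpow (hu (ne hδ) hδε (ne hε).symm j p.1) hs hp).congr_right
        (vpow_inv_mul (hc (ne hε).symm p.1) hp)
    have h4 := (h3.mul_right (ih hw hδ j hs)).mul_right h3.inv_right
    refine h4.congr_right ?_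
    have := h2.eq
    simp only [Cong, map_mul, map_inv, mul_inv_rev, inv_inv]
    generalize cls R N 2 ⁅(powProd (X β) w)⁻¹, (X β k)⁻¹ * X γ k⁆ = g at *
    generalize cls R N 2 (vpow (X ε p.1) p.2) = t at *
    generalize cls R N 2 (vpow (X β p.1) p.2) = y at *
    calc y⁻¹ * t * g * (t⁻¹ * y) = y⁻¹ * (t * g) * t⁻¹ * y := by group
      _ = _ := by rw [this]; group

/-- Four factors: `y(w)⁻¹ z(w)` commutes with the letters of the third colour. The product is peeled
from its first power `(k, e)`, which contributes the conjugate of `(y_k⁻¹ z_k) ^ e` by the rest of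
the word, that is a power of `[y(w)⁻¹, y_k⁻¹ z_k] y_k⁻¹ z_k`. -/
theorem comm_of_three_colours (h : ColourRelations fun α i => cls R N 0 (X α i))
    (h4 : ∀ {α β γ}, α ≠ β → α ≠ γ → β ≠ γ → ∀ i l k,
      Comm R N 0 (X α i) ⁅(X β l)⁻¹, (X β k)⁻¹ * X γ k⁆) {w : List (ι × (T → ℤ))}
    (hw : BoundedList N w) {α β γ : κ} (hαβ : α ≠ β) (hαγ : α ≠ γ) (hβγ : β ≠ γ) (j : ι) :
    Comm R N 3 (X α j) ((powProd (X β) w)⁻¹ * powProd (X γ) w) := by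
  induction w with
  | nil => simp only [powProd_nil, inv_one, mul_one, Comm, map_one]; exact Commute.one_right _
  | cons p w ih =>
    obtain ⟨hp, hw⟩ := boundedList_cons.mp hw
    set Y := powProd (X β) w with hY
    set u := (X β p.1)⁻¹ * X γ p.1 with hu
    have h1 : Comm R N 2 (X α j) (Y⁻¹ * u * Y⁻¹⁻¹) := by
      have e1 := comm_vpow_commutator_of_three_colours h h4 hw hαβ hαγ hβγ (Or.inl rfl) p.1 j
        bounded_one
      rw [vpow_one] at e1
      have e2 : Comm R N 0 (X α j) u := by
        have := h.commute_inv_mul hαβ hαγ hβγ j p.1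
        rwa [← map_inv, ← map_mul] at this
      have := e1.mul_right (e2.mono (Nat.zero_le _))
      rwa [commutatorElement_def, inv_mul_cancel_right] at this
    have h2 : Comm R N 3 _ _ := h1.vpow_right hp
    rw [conj_vpow] at h2
    have c0 : Comm R N 0 (X β p.1) (X γ p.1) := h.commute hβγ p.1
    have e3 := (vpow_inv_mul c0 hp).mono (show 2 ≤ 3 by norm_num)
    refine (h2.mul_right (ih hw)).congr_right ?_
    simp only [Cong, map_mul, map_inv, powProd_cons, mul_inv_rev, inv_inv] at e3 ⊢
    rw [e3, hY]
    group

end Products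

/-! ### Three factors: powers -/

section TriadPowers

variable {S T ι : Type*} {R : Set (FreeGroup S)} {N : T → ℕ}

/-- The relations of a triad hold up to bounded area. -/
abbrev AsympTriad (R : Set (FreeGroup S)) (N : T → ℕ) (x y u : ι → T → FreeGroup S) : Prop :=
  Triad (fun i => cls R N 0 (x i)) (fun i => cls R N 0 (y i)) (fun i => cls R N 0 (u i))

namespace AsympTriad

variable {x y u : ι → T → FreeGroup S} (h : AsympTriad R N x y u)
include h

theorem cong_mul (i : ι) : Cong R N 0 (x i) (y i * u i) := by
  simpa only [Cong, map_mul] using h.eq_mul i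

theorem comm_yu (i : ι) : Comm R N 0 (y i) (u i) := h.commute i

theorem swap₀ (i j : ι) : Cong R N 0 ⁅x i, y j⁆ ⁅y i, x j⁆ := by
  simpa only [Cong, map_commutatorElement] using h.swap i j

theorem comm₀ (k i j : ι) : Comm R N 0 (u k) ⁅y i, x j⁆ := by
  have := h.comm k i j
  rw [h.swap] at this
  simpa only [Comm, map_commutatorElement] using this

theorem comm_comm₀ (i j k l : ι) : Comm R N 0 ⁅u i, x j⁆ ⁅y k, x l⁆ := by
  have := h.comm_comm k l i j
  rw [h.swap, h.swap'] at this
  simpa only [Comm, map_commutatorElement] using this.symm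

/-- A power of `x_j = y_j u_j` splits. -/
theorem vpow_cong (j : ι) {f : T → ℤ} (hf : Bounded N f) :
    Cong R N 2 (vpow (x j) f) (vpow (y j) f * vpow (u j) f) :=
  (((h.cong_mul j).vpow hf).mono (by norm_num)).trans ((h.comm_yu j).mul_vpow hf)

/-- As `[Y, x_j ^ f] = ([Y, x_j] x_j) ^ f x_j ^ (-f)` and `x_j = y_j u_j`, the powers of `u_j`
cancel when `u_j` commutes with `[Y, x_j]`. -/
theorem commutator_vpow_cong {d : ℕ} {Y : T → FreeGroup S} {j : ι}
    (hY : Comm R N d ⁅Y, x j⁆ (u j)) {f : T → ℤ} (hf : Bounded N f) :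
    Cong R N (d + 2) ⁅Y, vpow (x j) f⁆ (vpow (⁅Y, x j⁆ * y j) f * (vpow (y j) f)⁻¹) := by
  have e1 : ⁅Y, vpow (x j) f⁆ = vpow (⁅Y, x j⁆ * x j) f * (vpow (x j) f)⁻¹ := by
    rw [show ⁅Y, x j⁆ * x j = Y * x j * Y⁻¹ by rw [commutatorElement_def]; group, conj_vpow,
      commutatorElement_def]
  have e2 : Cong R N d (⁅Y, x j⁆ * x j) (⁅Y, x j⁆ * y j * u j) := by
    rw [mul_assoc]
    exact (Cong.refl _).mul ((h.cong_mul j).mono (Nat.zero_le _))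
  have e3 := (e2.vpow hf).mono (show d + 1 ≤ d + 2 by omega)
  have e4 := (hY.mul_left ((h.comm_yu j).mono (Nat.zero_le _))).mul_vpow hf
  have e5 := (h.vpow_cong j hf).mono (show 2 ≤ d + 2 by omega)
  rw [e1]
  simp only [Cong, map_mul, map_inv] at *
  rw [e3, e4, e5]
  group

theorem commutator_vpow_swap {d : ℕ} {Y Z : T → FreeGroup S} {j : ι}
    (hY : Comm R N d ⁅Y, x j⁆ (u j)) (hYZ : Cong R N d ⁅Z, y j⁆ ⁅Y, x j⁆) {f : T → ℤ}
    (hf : Bounded N f) : Cong R N (d + 2) ⁅Z, vpow (y j) f⁆ ⁅Y, vpow (x j) f⁆ := by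
  have e1 : ⁅Z, vpow (y j) f⁆ = vpow (⁅Z, y j⁆ * y j) f * (vpow (y j) f)⁻¹ := by
    rw [show ⁅Z, y j⁆ * y j = Z * y j * Z⁻¹ by rw [commutatorElement_def]; group, conj_vpow,
      commutatorElement_def]
  have e2 := ((hYZ.mul (Cong.refl (y j))).vpow hf).mono (show d + 1 ≤ d + 2 by omega)
  rw [e1]
  exact (e2.mul (Cong.refl _)).trans (h.commutator_vpow_cong hY hf).symm

/-- The step that introduces a power of `x_j`: conjugation by `U` replaces `x_j = y_j u_j` by
`[U, x_j] y_j u_j`, and both are products of commuting factors, of which only the one that cancels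
is changed. -/
theorem comm_commutator_vpow {d : ℕ} {U Y : T → FreeGroup S} {j : ι}
    (h1 : Comm R N d ⁅Y, x j⁆ U) (h2 : Comm R N d ⁅Y, x j⁆ (u j))
    (h3 : Comm R N d ⁅U, x j⁆ (y j)) (h4 : Comm R N d ⁅U, x j⁆ ⁅Y, x j⁆) {f : T → ℤ}
    (hf : Bounded N f) : Comm R N (d + 2) U ⁅Y, vpow (x j) f⁆ := by
  set c := ⁅Y, x j⁆ with hc
  set a := ⁅U, x j⁆ with ha
  have hyu := (h.comm_yu j).mono (Nat.zero_le d)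
  have hx := (h.cong_mul j).mono (Nat.zero_le d)
  have e1 : U * ⁅Y, vpow (x j) f⁆ * U⁻¹ =
      vpow (U * (c * x j) * U⁻¹) f * (vpow (a * x j) f)⁻¹ := by
    rw [show c * x j = Y * x j * Y⁻¹ by rw [hc, commutatorElement_def]; group,
      show a * x j = U * x j * U⁻¹ by rw [ha, commutatorElement_def]; group, conj_vpow, conj_vpow,
      conj_vpow, commutatorElement_def]
    group
  have e2 : Cong R N d (U * (c * x j) * U⁻¹) (c * y j * (a * u j)) := by
    have e : U * (c * x j) * U⁻¹ = U * c * U⁻¹ * (a * x j) := by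
      rw [ha, commutatorElement_def]; group
    rw [e]
    simp only [Cong, map_mul, map_inv] at *
    rw [h1.symm.mul_inv_cancel, hx, mul_assoc (cls R N d c),
      ← mul_assoc (cls R N d a) (cls R N d (y j)),
      h3.eq, mul_assoc (cls R N d (y j))]
  have e3 : Cong R N d (a * x j) (y j * (a * u j)) := by
    simp only [Cong, map_mul] at *
    rw [hx, ← mul_assoc, h3.eq, mul_assoc]
  have k1 : Comm R N d (c * y j) (a * u j) :=
    (h4.symm.mul_left h3.symm).mul_right (h2.mul_left hyu)
  have k2 : Comm R N d (y j) (a * u j) := h3.symm.mul_right hyu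
  have e4 : Cong R N (d + 2) _ _ :=
    ((e2.vpow hf).mono (show d + 1 ≤ d + 2 by omega)).trans (k1.mul_vpow hf)
  have e5 : Cong R N (d + 2) _ _ :=
    ((e3.vpow hf).mono (show d + 1 ≤ d + 2 by omega)).trans (k2.mul_vpow hf)
  have e6 := h.commutator_vpow_cong h2 hf
  have e7 : Cong R N (d + 2) (U * ⁅Y, vpow (x j) f⁆ * U⁻¹) ⁅Y, vpow (x j) f⁆ := by
    rw [e1]
    refine (e4.mul e5.inv).trans (Eq.trans ?_ e6.symm)
    simp only [← hc, map_mul, map_inv]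
    group
  simp only [Cong, map_mul, map_inv] at e7
  exact mul_inv_eq_iff_eq_mul.mp e7

theorem swap₁ (l j : ι) {e : T → ℤ} (he : Bounded N e) :
    Cong R N 2 ⁅vpow (x l) e, y j⁆ ⁅vpow (y l) e, x j⁆ := by
  have h1 : Cong R N 0 ⁅x j, y l⁆ ⁅y j, x l⁆ := h.swap₀ j l
  have := (h.commutator_vpow_swap (h.comm₀ l j l).symm h1 he).inv
  rw [commutatorElement_inv, commutatorElement_inv] at this
  exact this.symm

theorem comm_comm_aux (k m l j : ι) {f : T → ℤ} (hf : Bounded N f) :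
    Comm R N 2 ⁅u k, x m⁆ ⁅y l, vpow (x j) f⁆ := by
  have h1 := h.commutator_vpow_cong (h.comm₀ j l j).symm hf
  have h2 : Comm R N 0 ⁅u k, x m⁆ (y j) := (AsympTriad.comm₀ h.symm j k m).symm
  exact ((((h.comm_comm₀ k m l j).mul_right h2).vpow_right hf).mono (by norm_num)).mul_right
    ((h2.vpow_right hf).mono (by norm_num)).inv_right |>.congr_right h1.symm

theorem comm₁ (k l j : ι) {e : T → ℤ} (he : Bounded N e) :
    Comm R N 2 (u k) ⁅vpow (y l) e, x j⁆ := by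
  have h1 := h.comm_commutator_vpow (h.comm₀ k j l).symm (h.comm₀ l j l).symm
    (AsympTriad.comm₀ h.symm l k l).symm (h.comm_comm₀ k l j l) he
  have h2 := h1.inv_right
  rw [commutatorElement_inv] at h2
  exact h2.congr_right (h.swap₁ l j he)

theorem comm_comm₁ (k m l j : ι) {s e : T → ℤ} (hs : Bounded N s) (he : Bounded N e) :
    Comm R N 3 ⁅vpow (u k) s, x m⁆ ⁅vpow (y l) e, x j⁆ := by
  have h1 := h.comm_comm_aux m k j l he
  have h2 : Comm R N 2 (u k) ⁅y j, vpow (x l) e⁆ := by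
    have := (h.comm₁ k l j he).congr_right (h.swap₁ l j he).symm
    simpa only [commutatorElement_inv] using this.inv_right
  have h3 := AsympTriad.commutator_vpow_cong h.symm (AsympTriad.comm₀ h.symm k m k).symm hs
  have h4 : Comm R N 3 ⁅u m, vpow (x k) s⁆ ⁅y j, vpow (x l) e⁆ :=
    (((h1.mul_left h2).vpow_left hs).mul_left (h2.vpow_left hs).inv_left).congr_left
      (Cong.mono h3.symm (by norm_num))
  have h5 := h4.inv_left.inv_right
  rw [commutatorElement_inv, commutatorElement_inv] at h5
  exact (h5.congr_left ((AsympTriad.swap₁ h.symm k m hs).mono (by norm_num))).congr_right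
    ((h.swap₁ l j he).mono (by norm_num))

theorem comm₂ (k l j : ι) {s e f : T → ℤ} (hs : Bounded N s) (he : Bounded N e)
    (hf : Bounded N f) : Comm R N 5 (vpow (u k) s) ⁅vpow (y l) e, vpow (x j) f⁆ :=
  h.comm_commutator_vpow ((h.comm₁ k l j he).vpow_left hs).symm
    ((h.comm₁ j l j he).mono (by norm_num)).symm
    ((AsympTriad.comm₁ h.symm j k j hs).mono (by norm_num)).symm (h.comm_comm₁ k j l j hs he) hf

theorem comm_comm₂ (k m l j : ι) {s b e : T → ℤ} (hs : Bounded N s) (hb : Bounded N b)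
    (he : Bounded N e) :
    Comm R N 4 ⁅vpow (u k) s, vpow (x m) b⁆ ⁅vpow (y l) e, x j⁆ := by
  have h1 := AsympTriad.commutator_vpow_cong h.symm (AsympTriad.comm₁ h.symm m k m hs).symm hb
  have h2 := h.comm_comm₁ k m l j hs he
  have h3 := (h.comm₁ m l j he).mono (show 2 ≤ 3 by norm_num)
  exact (((h2.mul_left h3).vpow_left hb).mul_left (h3.vpow_left hb).inv_left).congr_left h1.symm

/-! ### Three factors: products of powers -/

/-- Conjugation by `x_l ^ e` and by `y_l ^ e` agree on whatever commutes with `u_l ^ e`. -/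
theorem conj_vpow_cong {g : T → FreeGroup S} {l : ι} {e : T → ℤ} (he : Bounded N e)
    (hg : Comm R N 5 (vpow (u l) e) g) :
    Cong R N 5 (vpow (y l) e * g * (vpow (y l) e)⁻¹) (vpow (x l) e * g * (vpow (x l) e)⁻¹) := by
  apply Comm.conj_cong
  refine hg.congr_left ?_
  have := (h.vpow_cong l he).mono (show 2 ≤ 5 by norm_num)
  simp only [Cong, map_mul, map_inv] at *
  rw [this, inv_mul_cancel_left]

omit h in
theorem commutator_powProd_cons (x y : ι → T → FreeGroup S) (p : ι × (T → ℤ))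
    (w : List (ι × (T → ℤ))) (j : ι) : ⁅powProd x (p :: w), y j⁆ =
      vpow (x p.1) p.2 * ⁅powProd x w, y j⁆ * (vpow (x p.1) p.2)⁻¹ *
        ⁅vpow (x p.1) p.2, y j⁆ := by
  simp only [powProd_cons, commutatorElement_def]; group

/-- Both statements are proved together: conjugating `u_k ^ s` by `x_l ^ e` produces the commutator
`[u_k ^ s, x_l ^ e]`, and conjugating `[x(w), y_j]` by `x_l ^ e` may be replaced by conjugating it
by `y_l ^ e`. No powers of commutators arise, so the degree does not grow with the length of `w`. -/
theorem comm_powProd_aux (j : ι) {w : List (ι × (T → ℤ))} (hw : BoundedList N w) :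
    (∀ k {s : T → ℤ}, Bounded N s → Comm R N 5 (vpow (u k) s) ⁅powProd x w, y j⁆) ∧
    (∀ k m {s b : T → ℤ}, Bounded N s → Bounded N b →
      Comm R N 5 ⁅vpow (u k) s, vpow (x m) b⁆ ⁅powProd x w, y j⁆) := by
  induction w with
  | nil =>
    simp only [powProd_nil, commutatorElement_one_left, Comm, map_one]
    exact ⟨fun _ _ _ => Commute.one_right _, fun _ _ _ _ _ _ => Commute.one_right _⟩
  | cons p w ih =>
    obtain ⟨hp, hw⟩ := boundedList_cons.mp hw
    obtain ⟨ih1, ih2⟩ := ih hw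
    have hsw := h.swap₁ p.1 j hp
    rw [commutator_powProd_cons]
    refine ⟨fun k s hs => Comm.mul_right ?_ ?_, fun k m s b hs hb => Comm.mul_right ?_ ?_⟩
    · rw [Comm.conj_iff]
      have e : (vpow (x p.1) p.2)⁻¹ * vpow (u k) s * vpow (x p.1) p.2 =
          vpow (u k) s * ⁅vpow (u k) (-s), vpow (x p.1) (-p.2)⁆ := by
        rw [vpow_neg, vpow_neg, commutatorElement_def]; group
      rw [e]
      exact (ih1 k hs).mul_left (ih2 k p.1 hs.neg hp.neg)
    · exact ((((h.comm₁ k p.1 j hp).vpow_left hs).congr_right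
        (Cong.mono hsw.symm (by norm_num))).mono (by norm_num))
    · have h1 : Comm R N 5 ⁅vpow (u k) s, vpow (x m) b⁆ (vpow (y p.1) p.2) :=
        (AsympTriad.comm₂ h.symm p.1 k m hp hs hb).symm
      exact ((h1.mul_right (ih2 k m hs hb)).mul_right h1.inv_right).congr_right
        (h.conj_vpow_cong hp (ih1 p.1 hp))
    · exact ((h.comm_comm₂ k m p.1 j hs hb hp).congr_right
        (Cong.mono hsw.symm (by norm_num))).mono (by norm_num)

theorem comm_powProd (k j : ι) {w : List (ι × (T → ℤ))} (hw : BoundedList N w) {s : T → ℤ}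
    (hs : Bounded N s) : Comm R N 5 (vpow (u k) s) ⁅powProd x w, y j⁆ :=
  (h.comm_powProd_aux j hw).1 k hs

theorem swap_powProd (j : ι) {w : List (ι × (T → ℤ))} (hw : BoundedList N w) :
    Cong R N 5 ⁅powProd y w, x j⁆ ⁅powProd x w, y j⁆ := by
  induction w with
  | nil => simp only [powProd_nil, commutatorElement_one_left, Cong]
  | cons p w ih =>
    obtain ⟨hp, hw⟩ := boundedList_cons.mp hw
    rw [commutator_powProd_cons, commutator_powProd_cons]
    refine Cong.mul ?_ ((h.swap₁ p.1 j hp).mono (by norm_num)).symm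
    exact ((Cong.refl _).conj (ih hw)).trans (h.conj_vpow_cong hp (h.comm_powProd p.1 j hw hp))

theorem comm_powProd_powProd (k j : ι) {v w : List (ι × (T → ℤ))} (hv : BoundedList N v)
    (hw : BoundedList N w) : Comm R N 5 ⁅powProd x v, u k⁆ ⁅powProd x w, y j⁆ := by
  induction v with
  | nil =>
    simp only [powProd_nil, commutatorElement_one_left, Comm, map_one]
    exact Commute.one_left _
  | cons p v ih =>
    obtain ⟨hp, hv⟩ := boundedList_cons.mp hv
    rw [commutator_powProd_cons]
    refine Comm.mul_left ?_ ?_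
    · have h1 := h.comm_powProd p.1 j hw hp
      exact ((h1.mul_left (ih hv)).mul_left h1.inv_left).congr_left
        (AsympTriad.conj_vpow_cong h.symm hp (AsympTriad.comm_powProd h.symm p.1 k hv hp))
    · have := ((h.comm_powProd_aux j hw).2 k p.1 bounded_one hp).inv_left
      rwa [vpow_one, commutatorElement_inv] at this

theorem comm_conj_powProd (i j : ι) {v w : List (ι × (T → ℤ))} (hv : BoundedList N v)
    (hw : BoundedList N w) :
    Comm R N 5 ⁅(powProd x v)⁻¹ * powProd y v, x i⁆ (powProd x w * y j * (powProd x w)⁻¹) := by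
  have hy : ∀ k, Comm R N 5 (y k) ⁅(powProd x v)⁻¹, u i⁆ := fun k => by
    have := AsympTriad.comm_powProd h.symm k i hv.invList bounded_one
    rwa [vpow_one, powProd_invList] at this
  have h1 : Comm R N 5 ⁅(powProd x v)⁻¹, u i⁆ (powProd x w * y j * (powProd x w)⁻¹) := by
    have := (h.comm_powProd_powProd i j hv.invList hw)
    rw [powProd_invList] at this
    have := this.mul_right (hy j).symm
    rwa [commutatorElement_def (powProd x w), inv_mul_cancel_right] at this
  refine h1.congr_left ?_
  have h2 := h.swap_powProd i hv
  have h3 := (h.cong_mul i).mono (Nat.zero_le 5)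
  have h4 := (hy i).eq
  rw [show ⁅(powProd x v)⁻¹ * powProd y v, x i⁆ =
    (powProd x v)⁻¹ * ⁅powProd y v, x i⁆ * x i * powProd x v * (x i)⁻¹ by
      simp only [commutatorElement_def]; group]
  simp only [Cong, map_mul, map_inv, commutatorElement_def] at h2 h3 h4 ⊢
  rw [h2, h3]
  generalize cls R N 5 (powProd x v) = A at *
  generalize cls R N 5 (y i) = b at *
  generalize cls R N 5 (u i) = c at *
  calc A⁻¹ * c * A⁻¹⁻¹ * c⁻¹ = b * (A⁻¹ * c * A⁻¹⁻¹ * c⁻¹) * b⁻¹ := by rw [h4]; group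
    _ = _ := by group

end AsympTriad

/-- With two colours only, the relations between the two families of letters provide what the
pushing argument needs, with area `O(N ^ 5)`. -/
theorem pushRelations_of_pairRelations {κ : Type*} {X : κ → ι → T → FreeGroup S}
    (h2 : ∀ α β γ : κ, α ≠ β → α ≠ γ → β = γ)
    (h : ∀ {α β}, α ≠ β →
      PairRelations (fun i => cls R N 0 (X α i)) (fun i => cls R N 0 (X β i))) :
    PushRelations R N 5 X := by
  have ht : ∀ {α β}, α ≠ β →
      AsympTriad R N (X α) (X β) (fun i => X α i * (X β i)⁻¹) := fun hαβ => by
    have := (h hαβ).triad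
    simpa only [AsympTriad, map_mul, map_inv] using this
  refine ⟨fun {α β} hαβ i => ?_, ?_, fun hαβ j w hw => (ht hαβ).swap_powProd j hw,
    fun hαβ i j v w hv hw => (ht hαβ).comm_conj_powProd i j hv hw⟩
  · have h0 : Comm R N 0 (X α i) (X β i) := (h hαβ).commute i
    exact h0.mono (Nat.zero_le _)
  · intro α β γ h1 h3 j w hw
    rw [h2 α β γ h1 h3]

end TriadPowers

/-! ### Pushing a square of the product into the kernel -/

section Squares

variable {S T ι κ : Type*} {R : Set (FreeGroup S)} {N : T → ℕ} {d : ℕ}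
  {X : κ → ι → T → FreeGroup S}

namespace PushRelations

variable (h : PushRelations R N d X)
include h

/-- The commutator `[w, x_j]`, where `w` and `x_j` have different colours, does not depend on these
colours. -/
theorem commutator_cong {α β α' β' : κ} (hαβ : α ≠ β) (hαβ' : α' ≠ β') (j : ι)
    {w : List (ι × (T → ℤ))} (hw : BoundedList N w) :
    Cong R N d ⁅powProd (X β) w, X α j⁆ ⁅powProd (X β') w, X α' j⁆ := by
  have hrec : ∀ {α β γ}, α ≠ β → α ≠ γ →
      Cong R N d ⁅powProd (X β) w, X α j⁆ ⁅powProd (X γ) w, X α j⁆ := fun h1 h2 =>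
    Cong.mul (h.recolour h1 h2 j hw) (Cong.refl _)
  by_cases e : α = α'
  · subst e
    exact hrec hαβ hαβ'
  · exact (hrec hαβ e).trans ((h.swap e j hw).trans (hrec (Ne.symm e) hαβ'))

/-- The elements `x_i y_i⁻¹` commute with `[w(y), x_j]`: compare the swap relations for `w` and for
the product of the `i`-th letter with `w`. -/
theorem comm_div_commutator {α β : κ} (hαβ : α ≠ β) (i j : ι) {w : List (ι × (T → ℤ))}
    (hw : BoundedList N w) : Comm R N d (X α i * (X β i)⁻¹) ⁅powProd (X β) w, X α j⁆ := by
  have h1 := h.swap hαβ j (hw.cons (p := (i, 1)) bounded_one)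
  have h2 := h.swap hαβ j hw
  have h3 := h.swap hαβ j (w := [(i, 1)]) (boundedList_nil.cons bounded_one)
  have h4 : Cong R N d (X β i * ⁅powProd (X β) w, X α j⁆ * (X β i)⁻¹)
      (X α i * ⁅powProd (X β) w, X α j⁆ * (X α i)⁻¹) := by
    refine Eq.trans ?_ ((Cong.refl _).conj h2).symm
    have e : ∀ x : T → FreeGroup S, ∀ γ, X γ i * ⁅powProd (X γ) w, x⁆ * (X γ i)⁻¹ =
        ⁅X γ i * powProd (X γ) w, x⁆ * ⁅X γ i, x⁆⁻¹ := by
      intro x γ; simp only [commutatorElement_def]; group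
    rw [e, e]
    simp only [powProd_cons, powProd_nil, vpow_one, mul_one] at h1 h3
    exact h1.mul h3.inv
  have h5 := (Comm.of_conj_cong h4.symm).inv_left
  rw [mul_inv_rev, inv_inv] at h5
  refine h5.congr_left ?_
  have := (h.commute hαβ i).inv_right.eq
  simp only [Cong, map_mul, map_inv] at this ⊢
  exact this.symm

theorem square_of_eq {α β : κ} (hαβ : α ≠ β) (i : ι) {v : List (ι × (T → ℤ))}
    (hv : BoundedList N v) :
    Cong R N d
      (powProd (X β) v * X α i * (powProd (X β) v)⁻¹ *
        (powProd (X α) v * X β i * (powProd (X α) v)⁻¹))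
      (powProd (X α) v * X β i * (powProd (X α) v)⁻¹ *
        (powProd (X β) v * X α i * (powProd (X β) v)⁻¹)) := by
  have h1 := h.comm hαβ i i hv boundedList_nil
  simp only [powProd_nil, one_mul, inv_one, mul_one] at h1
  have h2 := (h1.mul_left (h.commute hαβ i)).eq
  simp only [commutatorElement_def, Cong, map_mul, map_inv] at h2 ⊢
  generalize cls R N d (powProd (X α) v) = A at *
  generalize cls R N d (powProd (X β) v) = B at *
  generalize cls R N d (X α i) = a at *
  generalize cls R N d (X β i) = b at *
  have h3 := congrArg (fun t => A * t * A⁻¹) h2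
  simpa [mul_assoc] using h3

theorem square_of_lt {α β : κ} (hαβ : α ≠ β) (i j : ι) {v w : List (ι × (T → ℤ))}
    (hv : BoundedList N v) (hw : BoundedList N w) :
    Cong R N d
      (powProd (X β) v * X α i * (powProd (X β) v)⁻¹ *
        (powProd (X α) v * (X α i)⁻¹ * powProd (X α) w * X β j *
          (powProd (X α) v * (X α i)⁻¹ * powProd (X α) w)⁻¹))
      (powProd (X α) v * powProd (X α) w * X β j * (powProd (X α) v * powProd (X α) w)⁻¹ *
        (powProd (X β) v * X α i * (powProd (X β) v)⁻¹)) := by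
  have h2 := (h.comm hαβ i j hv hw).eq
  simp only [commutatorElement_def, Cong, map_mul, map_inv] at h2 ⊢
  generalize cls R N d (powProd (X α) v) = A at *
  generalize cls R N d (powProd (X α) w) = W at *
  generalize cls R N d (powProd (X β) v) = B at *
  generalize cls R N d (X α i) = a at *
  generalize cls R N d (X β j) = b at *
  have h3 := congrArg (fun t => A * t * a * A⁻¹) h2
  simpa [mul_assoc] using h3

theorem square_last_of_le {α β : κ} (hαβ : α ≠ β) (i j : ι) (V : T → FreeGroup S)
    {w w' : List (ι × (T → ℤ))} (hw : BoundedList N w) (hw' : BoundedList N w') :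
    Cong R N d
      (V * X α i * V⁻¹ * (⁅V * (X β i)⁻¹ * powProd (X β) w, X α j⁆ *
        ⁅V * (X β i)⁻¹ * powProd (X β) w', X α j⁆⁻¹))
      (⁅V * powProd (X β) w, X α j⁆ * ⁅V * powProd (X β) w', X α j⁆⁻¹ * (V * X α i * V⁻¹)) := by
  have h1 := ((h.comm_div_commutator hαβ i j hw).mul_right
    (h.comm_div_commutator hαβ i j hw').inv_right).eq
  simp only [commutatorElement_def, Cong, map_mul, map_inv] at h1 ⊢
  generalize cls R N d V = A at *
  generalize cls R N d (powProd (X β) w) = W at *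
  generalize cls R N d (powProd (X β) w') = W' at *
  generalize cls R N d (X α i) = a at *
  generalize cls R N d (X β i) = b at *
  generalize cls R N d (X α j) = c at *
  have h3 := congrArg (fun t => A * t * b * A⁻¹) h1
  simpa [mul_assoc] using h3

theorem square_last_of_lt {α β : κ} (hαβ : α ≠ β) (i j : ι) (V : T → FreeGroup S)
    {v w : List (ι × (T → ℤ))} (hv : BoundedList N v) (hw : BoundedList N w) :
    Cong R N d
      (V * powProd (X β) v * X α i * (V * powProd (X β) v)⁻¹ *
        (⁅V * powProd (X β) v * (X β i)⁻¹ * powProd (X β) w, X α j⁆ * ⁅V, X α j⁆⁻¹))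
      (⁅V * powProd (X β) v * powProd (X β) w, X α j⁆ * ⁅V, X α j⁆⁻¹ *
        (V * X β j * powProd (X β) v * X α i * (V * X β j * powProd (X β) v)⁻¹)) := by
  have h1 := h.swap hαβ j (hv.append hw)
  have h2 := h.swap hαβ j (hv.append (hw.cons (p := (i, -1)) bounded_one.neg))
  have h3 := (h.comm hαβ i j hv hw).eq
  simp only [powProd_append, powProd_cons, vpow_neg, vpow_one, commutatorElement_def, Cong, map_mul,
    map_inv] at h1 h2 h3 ⊢
  generalize cls R N d V = A at *
  generalize cls R N d (powProd (X β) w) = w₂ at *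
  generalize cls R N d (powProd (X α) w) = w₁ at *
  generalize cls R N d (powProd (X β) v) = v₂ at *
  generalize cls R N d (powProd (X α) v) = v₁ at *
  generalize cls R N d (X α i) = a at *
  generalize cls R N d (X β i) = b at *
  generalize cls R N d (X α j) = c at *
  generalize cls R N d (X β j) = e at *
  have h4 := congrArg (fun t => A * v₁ * t * a * v₁⁻¹ * e⁻¹ * A⁻¹) h3
  calc _ = A * v₂ * a * v₂⁻¹ * (v₂ * (b⁻¹ * w₂) * c * (v₂ * (b⁻¹ * w₂))⁻¹ * c⁻¹) * A⁻¹ := by group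
    _ = A * v₂ * a * v₂⁻¹ * (v₁ * (a⁻¹ * w₁) * e * (v₁ * (a⁻¹ * w₁))⁻¹ * e⁻¹) * A⁻¹ := by rw [h2]
    _ = A * (v₁ * w₁ * e * (v₁ * w₁)⁻¹ * e⁻¹) * e * v₂ * a * v₂⁻¹ * e⁻¹ * A⁻¹ := by
      simpa [mul_assoc] using h4
    _ = A * (v₂ * w₂ * c * (v₂ * w₂)⁻¹ * c⁻¹) * e * v₂ * a * v₂⁻¹ * e⁻¹ * A⁻¹ := by rw [h1]
    _ = _ := by group

end PushRelations

end Squares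

/-! ### The section and the pushing map on letters -/

section Push

variable {κ : Type*} {r : ℕ}

/-- The indices `k` with `l ≤ k < h`, in increasing order. -/
def seg (r l h : ℕ) : List (Fin r) :=
  (List.Ico l h).filterMap fun k => if hk : k < r then some ⟨k, hk⟩ else none

theorem seg_append {l m h : ℕ} (h1 : l ≤ m) (h2 : m ≤ h) :
    seg r l h = seg r l m ++ seg r m h := by
  rw [seg, ← List.Ico.append_consecutive h1 h2, List.filterMap_append]; rfl

theorem seg_cons (i : Fin r) {h : ℕ} (hi : (i : ℕ) < h) : seg r i h = i :: seg r (i + 1) h := by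
  rw [seg, List.Ico.eq_cons hi]
  simp [seg]

theorem seg_succ {l : ℕ} (i : Fin r) (hi : l ≤ i) : seg r l (i + 1) = seg r l i ++ [i] := by
  rw [seg_append hi (Nat.le_succ _), seg_cons i (Nat.lt_succ_self _)]
  simp [seg]

theorem mem_seg {l h : ℕ} {k : Fin r} : k ∈ seg r l h ↔ l ≤ k ∧ (k : ℕ) < h := by
  simp only [seg, List.mem_filterMap, List.Ico.mem, Option.dite_none_right_eq_some]
  constructor
  · rintro ⟨m, hm, hm', h2⟩
    simp only [Option.some.injEq] at h2
    subst h2; exact hm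
  · intro hk
    exact ⟨k, hk, k.isLt, rfl⟩

/-- The product of the powers `x_k ^ v_k` of the letters of colour `α` over a list of indices. -/
def sectionWord (α : κ) (L : List (Fin r)) (v : Fin r → ℤ) : FreeGroup (κ × Fin r) :=
  (L.map fun k => FreeGroup.of (α, k) ^ v k).prod

/-- The alphabet of the product of free groups: `(some α, i)` stands for `a_i^{(α)}` and `(none, j)`
for the inverse `b_j` of the `j`-th letter of the last factor. -/
abbrev ProductLetter (κ : Type*) (r : ℕ) : Type _ := Option κ × Fin r

/-- The change of height along a letter; the height is minus the image in `ℤ ^ r`. -/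
def letterHeight : ProductLetter κ r → Fin r → ℤ
  | (some _, i) => -Pi.single i 1
  | (none, j) => Pi.single j 1

/-- The word in the generators of the kernel that represents `σ(v) a σ(v')⁻¹`, where `a` is a letter
from height `v` to height `v'` and `σ(v) = b_1 ^ v_1 ⋯ b_r ^ v_r` in the last factor. Here `c` picks
a colour different from the given one, and `δ₀` is any colour. -/
def pushLetter (c : κ → κ) (δ₀ : κ) (v : Fin r → ℤ) : ProductLetter κ r → FreeGroup (κ × Fin r)
  | (some α, i) => sectionWord (c α) (seg r 0 i) v * FreeGroup.of (α, i) *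
      (sectionWord (c α) (seg r 0 i) v)⁻¹
  | (none, j) => ⁅sectionWord (c δ₀) (seg r 0 r) v, FreeGroup.of (δ₀, j)⁆ *
      ⁅sectionWord (c δ₀) (seg r 0 (j + 1)) v, FreeGroup.of (δ₀, j)⁆⁻¹

variable {T : Type*} {N : T → ℕ}

/-- The letters, as constant families. -/
def constLetter (T : Type*) (α : κ) (i : Fin r) : T → FreeGroup (κ × Fin r) :=
  fun _ => FreeGroup.of (α, i)

/-- The family of words `σ(v)`, restricted to the indices `l ≤ k < h`, for a family of heights. -/
def segProd (α : κ) (l h : ℕ) (V : T → Fin r → ℤ) : T → FreeGroup (κ × Fin r) :=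
  powProd (constLetter T α) ((seg r l h).map fun k => (k, fun t => V t k))

theorem segProd_apply (α : κ) (l h : ℕ) (V : T → Fin r → ℤ) (t : T) :
    segProd α l h V t = sectionWord α (seg r l h) (V t) := by
  rw [segProd, sectionWord]
  generalize seg r l h = L
  induction L with
  | nil => rfl
  | cons k L ih =>
    simp only [List.map_cons, powProd_cons, List.prod_cons, Pi.mul_apply, ih]
    rfl

theorem segProd_eq_mul (α : κ) {l m h : ℕ} (h1 : l ≤ m) (h2 : m ≤ h) (V : T → Fin r → ℤ) :
    segProd α l h V = segProd α l m V * segProd α m h V := by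
  rw [segProd, seg_append h1 h2, List.map_append, powProd_append]; rfl

theorem segProd_congr (α : κ) {l h : ℕ} {V V' : T → Fin r → ℤ}
    (hV : ∀ k : Fin r, l ≤ k → (k : ℕ) < h → ∀ t, V t k = V' t k) :
    segProd α l h V = segProd α l h V' := by
  rw [segProd, segProd]
  congr 1
  refine List.map_congr_left fun k hk => ?_
  obtain ⟨h1, h2⟩ := mem_seg.mp hk
  exact Prod.ext rfl (funext (hV k h1 h2))

/-- The family of heights after a letter of one of the first factors. -/
def lowered (i : Fin r) (V : T → Fin r → ℤ) : T → Fin r → ℤ := fun t => V t + -Pi.single i 1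

/-- The family of heights after a letter of the last factor. -/
def raised (i : Fin r) (V : T → Fin r → ℤ) : T → Fin r → ℤ := fun t => V t + Pi.single i 1

theorem segProd_lowered_of_notMem (α : κ) {l h : ℕ} {i : Fin r} (hi : (i : ℕ) < l ∨ h ≤ i)
    (V : T → Fin r → ℤ) : segProd α l h (lowered i V) = segProd α l h V := by
  refine segProd_congr α fun k h1 h2 t => ?_
  have : k ≠ i := by rintro rfl; omega
  simp [lowered, this]

theorem segProd_raised_of_notMem (α : κ) {l h : ℕ} {i : Fin r} (hi : (i : ℕ) < l ∨ h ≤ i)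
    (V : T → Fin r → ℤ) : segProd α l h (raised i V) = segProd α l h V := by
  refine segProd_congr α fun k h1 h2 t => ?_
  have : k ≠ i := by rintro rfl; omega
  simp [raised, this]

theorem segProd_lowered (α : κ) {l h : ℕ} {i : Fin r} (h1 : l ≤ i) (h2 : (i : ℕ) < h)
    (V : T → Fin r → ℤ) : segProd α l h (lowered i V) =
      segProd α l i V * (constLetter T α i)⁻¹ * segProd α i h V := by
  have e : ∀ V : T → Fin r → ℤ, segProd α i h V =
      vpow (constLetter T α i) (fun t => V t i) * segProd α (i + 1) h V := by
    intro V
    rw [segProd, seg_cons i h2, List.map_cons, powProd_cons]; rfl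
  rw [segProd_eq_mul α h1 h2.le, segProd_lowered_of_notMem α (Or.inr le_rfl), e, e,
    segProd_lowered_of_notMem α (Or.inl (Nat.lt_succ_self _)), mul_assoc, ← mul_assoc _⁻¹]
  congr 2
  ext1 t
  simp only [vpow, lowered, Pi.add_apply, Pi.neg_apply, Pi.single_eq_same, Pi.mul_apply,
    Pi.inv_apply, zpow_add, zpow_neg, zpow_one]
  group

theorem segProd_raised (α : κ) {l h : ℕ} {j : Fin r} (h1 : l ≤ j) (h2 : (j : ℕ) < h)
    (V : T → Fin r → ℤ) : segProd α l h (raised j V) =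
      segProd α l (j + 1) V * constLetter T α j * segProd α (j + 1) h V := by
  have e : ∀ V : T → Fin r → ℤ, segProd α l (j + 1) V =
      segProd α l j V * vpow (constLetter T α j) (fun t => V t j) := by
    intro V
    rw [segProd, seg_succ j h1, List.map_append, powProd_append]
    simp [segProd]
  have e' : vpow (constLetter T α j) (fun t => raised j V t j) =
      vpow (constLetter T α j) (fun t => V t j) * constLetter T α j := by
    ext1 t
    simp only [vpow, raised, Pi.add_apply, Pi.single_eq_same, Pi.mul_apply, zpow_add, zpow_one]
  rw [segProd_eq_mul α (h1.trans (Nat.le_succ _)) h2, e, e,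
    segProd_raised_of_notMem α (Or.inr le_rfl),
    segProd_raised_of_notMem α (Or.inl (Nat.lt_succ_self _)), e']
  simp only [mul_assoc]

variable {R : Set (FreeGroup (κ × Fin r))} {d : ℕ}
  (h : PushRelations R N d (fun (α : κ) i => constLetter T α i))
  {c : κ → κ} (hc : ∀ α, α ≠ c α) (δ₀ : κ) {V : T → Fin r → ℤ}

theorem pushLetter_some (c : κ → κ) (δ₀ α : κ) (i : Fin r) (V : T → Fin r → ℤ) :
    (fun t => pushLetter c δ₀ (V t) (some α, i)) =
      segProd (c α) 0 i V * constLetter T α i * (segProd (c α) 0 i V)⁻¹ := by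
  ext1 t
  simp only [Pi.mul_apply, Pi.inv_apply, segProd_apply]; rfl

theorem pushLetter_none (c : κ → κ) (δ₀ : κ) (j : Fin r) (V : T → Fin r → ℤ) :
    (fun t => pushLetter c δ₀ (V t) (none, j)) =
      ⁅segProd (c δ₀) 0 r V, constLetter T δ₀ j⁆ *
        ⁅segProd (c δ₀) 0 (j + 1) V, constLetter T δ₀ j⁆⁻¹ := by
  ext1 t
  simp only [commutatorElement_def, Pi.mul_apply, Pi.inv_apply, segProd_apply]; rfl

theorem boundedList_seg (hV : ∀ k, Bounded N fun t => V t k) (l m : ℕ) :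
    BoundedList N ((seg r l m).map fun k => (k, fun t => V t k)) := by
  intro p hp
  obtain ⟨k, -, rfl⟩ := List.mem_map.mp hp
  exact hV k

include h hc

theorem pushLetter_some_cong {α β : κ} (hαβ : α ≠ β) (i : Fin r)
    (hV : ∀ k, Bounded N fun t => V t k) :
    Cong R N d (fun t => pushLetter c δ₀ (V t) (some α, i))
      (segProd β 0 i V * constLetter T α i * (segProd β 0 i V)⁻¹) := by
  rw [pushLetter_some]
  exact h.recolour (hc α) hαβ i (boundedList_seg hV _ _)

theorem pushLetter_none_cong {α β : κ} (hαβ : α ≠ β) (j : Fin r)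
    (hV : ∀ k, Bounded N fun t => V t k) :
    Cong R N d (fun t => pushLetter c δ₀ (V t) (none, j))
      (⁅segProd β 0 r V, constLetter T α j⁆ * ⁅segProd β 0 (j + 1) V, constLetter T α j⁆⁻¹) := by
  rw [pushLetter_none]
  exact (h.commutator_cong (hc δ₀) hαβ j (boundedList_seg hV _ _)).mul
    (h.commutator_cong (hc δ₀) hαβ j (boundedList_seg hV _ _)).inv

omit h hc in
theorem bounded_lowered {i : Fin r} (hV : ∀ t k, (V t k).natAbs ≤ N t) (k : Fin r) :
    Bounded N fun t => lowered i V t k := by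
  intro t
  have := hV t k
  by_cases e : k = i
  · subst e
    simp only [lowered, Pi.add_apply, Pi.neg_apply, Pi.single_eq_same]; omega
  · simp only [lowered, Pi.add_apply, Pi.neg_apply, Pi.single_eq_of_ne e]; omega

omit h hc in
theorem bounded_raised {i : Fin r} (hV : ∀ t k, (V t k).natAbs ≤ N t) (k : Fin r) :
    Bounded N fun t => raised i V t k := by
  intro t
  have := hV t k
  by_cases e : k = i
  · subst e
    simp only [raised, Pi.add_apply, Pi.single_eq_same]; omega
  · simp only [raised, Pi.add_apply, Pi.single_eq_of_ne e]; omega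

/-- The two ways around a square with letters from two of the first factors. -/
theorem pushLetter_square {α β : κ} (hαβ : α ≠ β) (i j : Fin r)
    (hV : ∀ t k, (V t k).natAbs ≤ N t) :
    Cong R N d
      ((fun t => pushLetter c δ₀ (V t) (some α, i)) *
        fun t => pushLetter c δ₀ (lowered i V t) (some β, j))
      ((fun t => pushLetter c δ₀ (V t) (some β, j)) *
        fun t => pushLetter c δ₀ (lowered j V t) (some α, i)) := by
  have hV' : ∀ k, Bounded N fun t => V t k := fun k t => (hV t k).trans (Nat.le_succ _)
  wlog hij : i ≤ j generalizing α β i j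
  · exact (this hαβ.symm j i (le_of_not_ge hij)).symm
  refine ((pushLetter_some_cong h hc δ₀ hαβ i hV').mul
    (pushLetter_some_cong h hc δ₀ hαβ.symm j (bounded_lowered hV))).trans
    (Eq.trans ?_ ((pushLetter_some_cong h hc δ₀ hαβ.symm j hV').mul
    (pushLetter_some_cong h hc δ₀ hαβ i (bounded_lowered hV))).symm)
  rw [segProd_lowered_of_notMem β (Or.inr hij)]
  rcases hij.lt_or_eq with hlt | rfl
  · rw [segProd_lowered α (Nat.zero_le _) hlt, segProd_eq_mul α (Nat.zero_le _) hij]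
    exact h.square_of_lt hαβ i j (boundedList_seg hV' _ _) (boundedList_seg hV' _ _)
  · rw [segProd_lowered_of_notMem α (Or.inr le_rfl)]
    exact h.square_of_eq hαβ i (boundedList_seg hV' _ _)

/-- The two ways around a square with a letter from the last factor. -/
theorem pushLetter_square_last (α : κ) (i j : Fin r) (hV : ∀ t k, (V t k).natAbs ≤ N t) :
    Cong R N d
      ((fun t => pushLetter c δ₀ (V t) (some α, i)) *
        fun t => pushLetter c δ₀ (lowered i V t) (none, j))
      ((fun t => pushLetter c δ₀ (V t) (none, j)) *
        fun t => pushLetter c δ₀ (raised j V t) (some α, i)) := by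
  have hV' : ∀ k, Bounded N fun t => V t k := fun k t => (hV t k).trans (Nat.le_succ _)
  have hb := fun l m => boundedList_seg hV' l m
  have hαβ := hc α
  generalize hβ : c α = β at hαβ
  refine ((pushLetter_some_cong h hc δ₀ hαβ i hV').mul
    (pushLetter_none_cong h hc δ₀ hαβ j (bounded_lowered hV))).trans
    (Eq.trans ?_ ((pushLetter_none_cong h hc δ₀ hαβ j hV').mul
    (pushLetter_some_cong h hc δ₀ hαβ i (bounded_raised hV))).symm)
  rcases le_or_gt i j with hij | hij
  · have hij' : (i : ℕ) < j + 1 := Nat.lt_succ_of_le hij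
    rw [segProd_raised_of_notMem β (Or.inr hij), segProd_lowered β (Nat.zero_le _) i.isLt,
      segProd_lowered β (Nat.zero_le _) hij', segProd_eq_mul β (Nat.zero_le _) i.isLt.le,
      segProd_eq_mul β (Nat.zero_le _) hij'.le]
    exact h.square_last_of_le hαβ i j _ (hb _ _) (hb _ _)
  · have hij' : (j : ℕ) + 1 ≤ i := hij
    rw [segProd_raised β (Nat.zero_le _) hij, segProd_lowered_of_notMem β (Or.inr hij'),
      segProd_lowered β (Nat.zero_le _) i.isLt, segProd_eq_mul β (Nat.zero_le _) i.isLt.le,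
      segProd_eq_mul β (Nat.zero_le _) hij']
    exact h.square_last_of_lt hαβ i j _ (hb _ _) (hb _ _)

end Push

/-! ### Crossed homomorphisms and sorting of words by factors -/

section Crossed

variable {A F H : Type*} [Group F] [AddCommGroup H]

/-- The action of the heights on families of words indexed by heights, by translation. -/
def shiftAut (F H : Type*) [Group F] [AddCommGroup H] : Multiplicative H →* MulAut (H → F) where
  toFun m :=
    { toFun := fun f v => f (v + m.toAdd)
      invFun := fun f v => f (v - m.toAdd)
      left_inv := fun f => by ext1 v; simp
      right_inv := fun f => by ext1 v; simp
      map_mul' := fun _ _ => rfl }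
  map_one' := by ext f v; simp
  map_mul' m m' := by ext f v; simp [add_assoc]

/-- The homomorphism to the semidirect product that encodes the crossed homomorphism
with values `p v a` on a letter `a` at height `v`. -/
def crossedHom (p : H → A → F) (ht : A → H) :
    FreeGroup A →* (H → F) ⋊[shiftAut F H] Multiplicative H :=
  FreeGroup.lift fun a => ⟨fun v => p v a, Multiplicative.ofAdd (ht a)⟩

/-- The crossed homomorphism with values `p v a` on a letter `a` at height `v`. -/
def crossed (p : H → A → F) (ht : A → H) (v : H) (g : FreeGroup A) : F :=
  (crossedHom p ht g).left v

/-- The change of height along a word. -/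
def height (ht : A → H) : FreeGroup A →* Multiplicative H :=
  FreeGroup.lift fun a => Multiplicative.ofAdd (ht a)

variable {p : H → A → F} {ht : A → H}

theorem crossedHom_right (g : FreeGroup A) : (crossedHom p ht g).right = height ht g := by
  have : SemidirectProduct.rightHom.comp (crossedHom p ht) = height ht := by
    ext a; simp [crossedHom, height]
  exact DFunLike.congr_fun this g

theorem crossed_of (v : H) (a : A) : crossed p ht v (FreeGroup.of a) = p v a := by
  simp [crossed, crossedHom]

theorem crossed_one (v : H) : crossed p ht v 1 = 1 := by simp [crossed]

theorem crossed_mul (v : H) (g h : FreeGroup A) : crossed p ht v (g * h) =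
    crossed p ht v g * crossed p ht (v + (height ht g).toAdd) h := by
  simp only [crossed, map_mul, SemidirectProduct.mul_left, Pi.mul_apply, crossedHom_right]
  rfl

theorem crossed_inv (v : H) (g : FreeGroup A) : crossed p ht v g⁻¹ =
    (crossed p ht (v - (height ht g).toAdd) g)⁻¹ := by
  rw [eq_inv_iff_mul_eq_one]
  have := crossed_mul (p := p) (ht := ht) v g⁻¹ g
  rw [inv_mul_cancel, crossed_one, map_inv, toAdd_inv, ← sub_eq_add_neg] at this
  exact this.symm

theorem crossed_mul_of_height {g : FreeGroup A} (hg : height ht g = 1) (v : H) (h : FreeGroup A) :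
    crossed p ht v (g * h) = crossed p ht v g * crossed p ht v h := by
  rw [crossed_mul, hg, toAdd_one, add_zero]

theorem crossed_inv_of_height {g : FreeGroup A} (hg : height ht g = 1) (v : H) :
    crossed p ht v g⁻¹ = (crossed p ht v g)⁻¹ := by
  rw [crossed_inv, hg, toAdd_one, sub_zero]

theorem crossed_conj {h : FreeGroup A} (hh : height ht h = 1) (v : H) (g : FreeGroup A) :
    crossed p ht v (g * h * g⁻¹) =
      crossed p ht v g * crossed p ht (v + (height ht g).toAdd) h * (crossed p ht v g)⁻¹ := by
  rw [crossed_mul, crossed_mul, crossed_inv]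
  simp [hh]

theorem crossed_commutator (v : H) (g h : FreeGroup A) : crossed p ht v ⁅g, h⁆ =
    crossed p ht v (g * h) * (crossed p ht v (h * g))⁻¹ := by
  have h1 : height ht ⁅g, h⁆ = 1 := by
    rw [map_commutatorElement, commutatorElement_eq_one_iff_commute]
    exact Commute.all _ _
  rw [eq_mul_inv_iff_mul_eq, ← crossed_mul_of_height h1]
  congr 1
  rw [commutatorElement_def]; group

theorem height_commutator (g h : FreeGroup A) : height ht ⁅g, h⁆ = 1 := by
  rw [map_commutatorElement, commutatorElement_eq_one_iff_commute]
  exact Commute.all _ _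

end Crossed

section Sorting

variable {A S Φ : Type*} {r : ℕ} {R : Set (FreeGroup S)} {p : (Fin r → ℤ) → A → FreeGroup S}
  {ht : A → Fin r → ℤ}

/-- The sup norm of a height is at most `m`. -/
def HeightLE (v : Fin r → ℤ) (m : ℕ) : Prop := ∀ k, (v k).natAbs ≤ m

/-- A letter or its inverse. -/
def signed (x : A × Bool) : FreeGroup A := FreeGroup.mk [x]

theorem signed_cases (x : A × Bool) :
    signed x = FreeGroup.of x.1 ∨ signed x = (FreeGroup.of x.1)⁻¹ := by
  rcases x with ⟨a, b⟩
  cases b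
  · right; rfl
  · left; rfl

theorem mk_cons (x : A × Bool) (L : List (A × Bool)) :
    FreeGroup.mk (x :: L) = signed x * FreeGroup.mk L := by
  rw [signed, FreeGroup.mul_mk]; rfl

theorem mk_nil_eq_one : FreeGroup.mk ([] : List (A × Bool)) = 1 := rfl

variable (hht : ∀ a, HeightLE (ht a) 1)
include hht

theorem heightLE_add_signed {v : Fin r → ℤ} {m : ℕ} (hv : HeightLE v m) (x : A × Bool) :
    HeightLE (v + (height ht (signed x)).toAdd) (m + 1) := by
  intro k
  have h1 := hv k
  have h2 := hht x.1 k
  rcases signed_cases x with h | h <;> rw [h]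
  · simp only [height, FreeGroup.lift_apply_of, toAdd_ofAdd, Pi.add_apply]; omega
  · simp only [height, map_inv, FreeGroup.lift_apply_of, toAdd_inv, toAdd_ofAdd, Pi.add_apply,
      Pi.neg_apply]
    omega

theorem heightLE_sub_of {v : Fin r → ℤ} {m : ℕ} (hv : HeightLE v m) (a : A) :
    HeightLE (v - (height ht (FreeGroup.of a)).toAdd) (m + 1) := by
  intro k
  have h1 := hv k
  have h2 := hht a k
  simp only [height, FreeGroup.lift_apply_of, toAdd_ofAdd, Pi.sub_apply]; omega

variable {fac : A → Φ} {D M : ℕ}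
  (hsq : ∀ a b, fac a ≠ fac b → ∀ v, HeightLE v M →
    area R (crossed p ht v ⁅FreeGroup.of a, FreeGroup.of b⁆) ≤ D)
include hsq

theorem area_crossed_commutator_signed_le {x y : A × Bool} (hxy : fac x.1 ≠ fac y.1)
    {v : Fin r → ℤ} {m : ℕ} (hv : HeightLE v m) (hm : m + 2 ≤ M) :
    area R (crossed p ht v ⁅signed x, signed y⁆) ≤ D := by
  -- `[g⁻¹, h] = g⁻¹ [g, h]⁻¹ g` moves the base point by the height of `g`
  have inv : ∀ {g h : FreeGroup A} {v},
      area R (crossed p ht (v - (height ht g).toAdd) ⁅g, h⁆) ≤ D →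
      area R (crossed p ht v ⁅g⁻¹, h⁆) ≤ D := by
    intro g h v hgh
    rw [show ⁅g⁻¹, h⁆ = g⁻¹ * ⁅g, h⁆⁻¹ * g⁻¹⁻¹ by simp only [commutatorElement_def]; group,
      crossed_conj (by rw [map_inv, height_commutator, inv_one])]
    refine area_conj_le _ ?_
    rw [crossed_inv_of_height (height_commutator _ _), map_inv, toAdd_inv, ← sub_eq_add_neg]
    exact area_inv_le hgh
  have symm : ∀ {g h : FreeGroup A} {v}, area R (crossed p ht v ⁅g, h⁆) ≤ D →
      area R (crossed p ht v ⁅h, g⁆) ≤ D := by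
    intro g h v hgh
    rw [← commutatorElement_inv, crossed_inv_of_height (height_commutator _ _)]
    exact area_inv_le hgh
  have mono : ∀ {v : Fin r → ℤ} {m m' : ℕ}, HeightLE v m → m ≤ m' → HeightLE v m' :=
    fun hv hm k => (hv k).trans hm
  have h1 : ∀ {v m}, HeightLE v m → m + 1 ≤ M →
      area R (crossed p ht v ⁅signed x, FreeGroup.of y.1⁆) ≤ D := by
    intro v m hv hm
    rcases signed_cases x with h | h <;> rw [h]
    · exact hsq _ _ hxy v (mono hv (by omega))
    · exact inv (hsq _ _ hxy _ (mono (heightLE_sub_of hht hv x.1) hm))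
  rcases signed_cases y with h | h <;> rw [h]
  · exact h1 hv (by omega)
  · exact symm (inv (symm (h1 (heightLE_sub_of hht hv y.1) (by omega))))

theorem area_crossed_commutator_mk_le {x : A × Bool} (L : List (A × Bool))
    (hL : ∀ y ∈ L, fac x.1 ≠ fac y.1) {v : Fin r → ℤ} {m : ℕ} (hv : HeightLE v m)
    (hm : m + L.length + 2 ≤ M) :
    area R (crossed p ht v ⁅signed x, FreeGroup.mk L⁆) ≤ (L.length * D : ℕ) := by
  induction L generalizing v m with
  | nil =>
    rw [mk_nil_eq_one, commutatorElement_one_right, crossed_one]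
    simpa using area_one_le
  | cons y L ih =>
    rw [mk_cons, show ⁅signed x, signed y * FreeGroup.mk L⁆ =
      ⁅signed x, signed y⁆ * (signed y * ⁅signed x, FreeGroup.mk L⁆ * (signed y)⁻¹) by
        simp only [commutatorElement_def]; group, crossed_mul_of_height (height_commutator _ _),
      crossed_conj (height_commutator _ _)]
    simp only [List.length_cons] at hm
    have h1 := area_crossed_commutator_signed_le hht hsq (hL y (by simp)) hv (by omega)
    have h2 := ih (fun z hz => hL z (by simp [hz])) (heightLE_add_signed hht hv y) (by omega)
    exact area_mono (area_mul_le h1 (area_conj_le _ h2)) (by rw [List.length_cons]; ring_nf; omega)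

variable [DecidableEq Φ]

/-- Moving the letters of the factor `φ` to the front of a word costs at most one square for each
pair of letters, and all of these squares lie at heights that the word can reach. -/
theorem area_crossed_partition_le (φ : Φ) (L : List (A × Bool)) {v : Fin r → ℤ} {m : ℕ}
    (hv : HeightLE v m) (hm : m + L.length + 2 ≤ M) :
    height ht (FreeGroup.mk L * (FreeGroup.mk (L.filter fun x => fac x.1 = φ) *
      FreeGroup.mk (L.filter fun x => fac x.1 ≠ φ))⁻¹) = 1 ∧
    area R (crossed p ht v (FreeGroup.mk L * (FreeGroup.mk (L.filter fun x => fac x.1 = φ) *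
      FreeGroup.mk (L.filter fun x => fac x.1 ≠ φ))⁻¹)) ≤ (L.length ^ 2 * D : ℕ) := by
  induction L generalizing v m with
  | nil =>
    simp only [List.filter_nil, mk_nil_eq_one, mul_one, inv_one, crossed_one, map_one, true_and]
    simpa using area_one_le
  | cons y L ih =>
    simp only [List.length_cons] at hm ⊢
    obtain ⟨ih1, ih2⟩ := ih (heightLE_add_signed hht hv y) (by omega)
    by_cases hy : fac y.1 = φ
    · rw [List.filter_cons_of_pos (by simpa using hy), List.filter_cons_of_neg (by simpa using hy),
        mk_cons, mk_cons]
      generalize FreeGroup.mk (L.filter fun x => fac x.1 = φ) = g at *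
      generalize FreeGroup.mk (L.filter fun x => fac x.1 ≠ φ) = h at *
      rw [show signed y * FreeGroup.mk L * (signed y * g * h)⁻¹ =
        signed y * (FreeGroup.mk L * (g * h)⁻¹) * (signed y)⁻¹ by group]
      refine ⟨by rw [map_mul, map_mul, ih1]; simp, ?_⟩
      rw [crossed_conj ih1]
      exact area_mono (area_conj_le _ ih2) (Nat.mul_le_mul_right _ (by gcongr; omega))
    · rw [List.filter_cons_of_neg (by simpa using hy), List.filter_cons_of_pos (by simpa using hy),
        mk_cons, mk_cons]
      have h1 := area_crossed_commutator_mk_le hht hsq (x := y)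
        (L.filter fun x => fac x.1 = φ) (by
          intro z hz
          have := (List.mem_filter.mp hz).2
          simp only [decide_eq_true_eq] at this
          rwa [this]) hv (by
          have := List.length_filter_le (fun x : A × Bool => decide (fac x.1 = φ)) L
          omega)
      replace h1 := area_mono h1 (Nat.mul_le_mul_right D (List.length_filter_le _ L))
      generalize FreeGroup.mk (L.filter fun x => fac x.1 = φ) = g at *
      generalize FreeGroup.mk (L.filter fun x => fac x.1 ≠ φ) = h at *
      rw [show signed y * FreeGroup.mk L * (g * (signed y * h))⁻¹ =
        signed y * (FreeGroup.mk L * (g * h)⁻¹) * (signed y)⁻¹ * ⁅signed y, g⁆ by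
          rw [commutatorElement_def]; group]
      have h2 : height ht (signed y * (FreeGroup.mk L * (g * h)⁻¹) * (signed y)⁻¹) = 1 := by
        rw [map_mul, map_mul, ih1]; simp
      refine ⟨by rw [map_mul, h2, height_commutator, one_mul], ?_⟩
      rw [crossed_mul_of_height h2, crossed_conj ih1]
      exact area_mono (area_mul_le (area_conj_le _ ih2) h1) (by nlinarith)

/-- If a word is trivial in each factor, its image under the crossed homomorphism has area at most
quadratic in its length, times the bound for the squares at the heights that it reaches. -/
theorem area_crossed_mk_le (Φs : List Φ) (L : List (A × Bool)) (hL : ∀ x ∈ L, fac x.1 ∈ Φs)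
    (h1 : ∀ φ, FreeGroup.mk (L.filter fun x => fac x.1 = φ) = 1) {v : Fin r → ℤ} {m : ℕ}
    (hv : HeightLE v m) (hm : m + L.length + 2 ≤ M) :
    area R (crossed p ht v (FreeGroup.mk L)) ≤ (Φs.length * (L.length ^ 2 * D) : ℕ) := by
  induction Φs generalizing L with
  | nil =>
    have : L = [] := List.eq_nil_iff_forall_not_mem.mpr fun x hx => by simpa using hL x hx
    subst this
    rw [mk_nil_eq_one, crossed_one]
    simpa using area_one_le
  | cons φ Φs ih =>
    obtain ⟨e1, e2⟩ := area_crossed_partition_le hht hsq φ L hv hm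
    rw [h1 φ, one_mul] at e1 e2
    have hlen : (L.filter fun x => fac x.1 ≠ φ).length ≤ L.length := List.length_filter_le _ _
    have e3 := ih (L.filter fun x => fac x.1 ≠ φ)
      (by
        intro x hx
        simp only [List.mem_filter, decide_eq_true_eq] at hx
        exact (List.mem_cons.mp (hL x hx.1)).resolve_left hx.2)
      (by
        intro ψ
        by_cases hψ : ψ = φ
        · subst hψ
          rw [List.filter_filter, List.filter_eq_nil_iff.mpr, mk_nil_eq_one]
          intro x _
          simp
        · rw [List.filter_filter, ← h1 ψ]
          congr 1
          refine List.filter_congr fun x _ => ?_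
          by_cases hx : fac x.1 = ψ <;> simp [hx, hψ])
      (by omega)
    rw [show FreeGroup.mk L = FreeGroup.mk L * (FreeGroup.mk (L.filter fun x => fac x.1 ≠ φ))⁻¹ *
      FreeGroup.mk (L.filter fun x => fac x.1 ≠ φ) by group, crossed_mul_of_height e1]
    refine area_mono (area_mul_le e2 e3) ?_
    have : (L.filter fun x => fac x.1 ≠ φ).length ^ 2 * D ≤ L.length ^ 2 * D := by gcongr
    rw [List.length_cons]
    nlinarith [Nat.mul_le_mul_left Φs.length this]

end Sorting

/-! ### The relators provide the relations used for pushing -/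

section Relators

variable {n r : ℕ}

theorem Fin.exists_notMem_of_card_lt {m : ℕ} (s : Finset (Fin m)) (hs : s.card < m) :
    ∃ x, x ∉ s := by
  obtain ⟨x, -, hx⟩ := Finset.exists_mem_notMem_of_card_lt_card
    (s := s) (t := Finset.univ) (by simpa using hs)
  exact ⟨x, hx⟩

variable {H : Type*} [Group H] (f : KernelWord n r →* H)

theorem commute_letter_of_relSimple (hf : ∀ w ∈ relSimple n r, f w = 1) {α β : Fin (n - 1)}
    (h : α ≠ β) (i : Fin r) : Commute (f (letter α i)) (f (letter β i)) := by
  rw [← commutatorElement_eq_one_iff_commute, ← map_commutatorElement]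
  exact hf _ ⟨i, α, β, h, rfl⟩

theorem colourRelations_of_relators (hf : ∀ w ∈ relSimple n r, f w = 1)
    (hf' : ∀ w ∈ relComm n r, f w = 1) :
    ColourRelations fun (α : Fin (n - 1)) (i : Fin r) => f (letter α i) where
  commute h i := commute_letter_of_relSimple f hf h i
  commute_div {α β γ} h1 h2 h3 i j := by
    by_cases hij : i = j
    · subst hij
      exact (commute_letter_of_relSimple f hf h1 i).mul_right
        (commute_letter_of_relSimple f hf h2 i).inv_right
    · rw [← map_inv, ← map_mul, ← commutatorElement_eq_one_iff_commute, ← map_commutatorElement]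
      exact hf' _ ⟨i, j, α, β, γ, hij, h1, h2, h3, rfl⟩

theorem commute_of_relTriple (hf : ∀ w ∈ relSimple n r, f w = 1)
    (hf' : ∀ w ∈ relTriple n r, f w = 1) {α β : Fin (n - 1)} (h : α ≠ β) {i j k : Fin r}
    (hij : i ≠ j) (hik : i ≠ k) (hjk : j ≠ k) (ε δ : ℤˣ) :
    Commute (f (letter α i)) ⁅f (letter β j) ^ (ε : ℤ),
      (f (letter α k) * (f (letter β k))⁻¹) ^ (δ : ℤ)⁆ := by
  have := hf' _ ⟨i, j, k, α, β, ε, δ, hij, hik, hjk, h, rfl⟩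
  rw [(commute_letter_of_relSimple f hf h k).inv_right.mul_zpow]
  rw [← commutatorElement_eq_one_iff_commute]
  simpa only [map_commutatorElement, map_mul, map_zpow, map_inv] using this

theorem pairRelations_of_relators (hf : ∀ w ∈ relSimple n r, f w = 1)
    (hf2 : ∀ w ∈ relSwap n r, f w = 1) (hf3 : ∀ w ∈ relTriple n r, f w = 1)
    (hf4 : ∀ w ∈ relQuad n r, f w = 1) {α β : Fin (n - 1)} (h : α ≠ β) :
    PairRelations (fun i : Fin r => f (letter α i)) (fun i => f (letter β i)) where
  commute i := commute_letter_of_relSimple f hf h i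
  swap i j ε δ := by
    by_cases hij : i = j
    · subst hij
      have := commute_letter_of_relSimple f hf h i
      rw [commutatorElement_eq_one_iff_commute.mpr (this.zpow_zpow _ _),
        commutatorElement_eq_one_iff_commute.mpr (this.symm.zpow_zpow _ _)]
    · have := hf2 _ ⟨i, j, α, β, ε, δ, hij, h, rfl⟩
      simp only [map_mul, map_commutatorElement, map_zpow] at this
      rw [eq_inv_of_mul_eq_one_left this, commutatorElement_inv]
  triple ε δ h1 h2 h3 := commute_of_relTriple f hf hf3 h h1 h2 h3 ε δ
  triple' ε δ h1 h2 h3 := by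
    have := commute_of_relTriple f hf hf3 h.symm h1 h2 h3 ε (-δ)
    rwa [coe_neg_units_zpow, ← inv_zpow, mul_inv_rev, inv_inv] at this
  quad {i j k l} δ τ h1 h2 h3 h4 h5 h6 := by
    have := hf4 _ ⟨i, j, k, l, α, β, 1, δ, 1, τ, h1, h2, h3, h4, h5, h6, h, rfl⟩
    rw [(commute_letter_of_relSimple f hf h k).inv_right.mul_zpow,
      (commute_letter_of_relSimple f hf h l).inv_right.mul_zpow,
      ← commutatorElement_eq_one_iff_commute]
    simpa only [map_commutatorElement, map_mul, map_zpow, map_inv, Units.val_one, zpow_one]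
      using this

theorem PushRelations.mono {S T ι κ : Type*} {R : Set (FreeGroup S)} {N : T → ℕ} {d d' : ℕ}
    {X : κ → ι → T → FreeGroup S} (h : PushRelations R N d X) (hd : d ≤ d') :
    PushRelations R N d' X where
  commute h1 i := (h.commute h1 i).mono hd
  recolour h1 h2 j _ hw := (h.recolour h1 h2 j hw).mono hd
  swap h1 j _ hw := (h.swap h1 j hw).mono hd
  comm h1 i j _ _ hv hw := (h.comm h1 i j hv hw).mono hd

/-- The three cases of the main estimate: a fourth colour for `n ≥ 5`, three colours for `n = 4`,
and two colours for `n = 3`, where degree `5` would suffice. -/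
theorem pushRelations_relators (hn : 3 ≤ n) {T : Type*} (N : T → ℕ) :
    PushRelations (relators n r) N (dExp n)
      (fun (α : Fin (n - 1)) (i : Fin r) => constLetter T α i) := by
  have hone : ∀ w ∈ relators n r, constCls (relators n r) N w = 1 := fun w hw => constCls_eq_one hw
  have hcomm (h3 : n ≠ 3) : ColourRelations fun (α : Fin (n - 1)) (i : Fin r) =>
      cls (relators n r) N 0 (constLetter T α i) :=
    colourRelations_of_relators (constCls (relators n r) N)
      (fun w hw => hone w (by
        rw [relators, if_neg h3]; split_ifs
        exacts [Or.inl (Or.inl hw), Or.inl hw]))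
      (fun w hw => hone w (by
        rw [relators, if_neg h3]; split_ifs
        exacts [Or.inl (Or.inr hw), Or.inr hw]))
  have third (h4 : 4 ≤ n) (α β : Fin (n - 1)) : ∃ γ, γ ≠ α ∧ γ ≠ β := by
    obtain ⟨γ, hγ⟩ := Fin.exists_notMem_of_card_lt {α, β}
      (lt_of_le_of_lt Finset.card_le_two (by omega))
    exact ⟨γ, by simpa using hγ⟩
  rcases (show n = 3 ∨ n = 4 ∨ 5 ≤ n by omega) with rfl | rfl | h5
  · refine PushRelations.mono (d := 5) (pushRelations_of_pairRelations (by omega) ?_)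
      (by simp [dExp])
    intro α β hαβ
    exact pairRelations_of_relators (constCls (relators 3 r) N)
      (fun w hw => hone w (by simp [relators, hw])) (fun w hw => hone w (by simp [relators, hw]))
      (fun w hw => hone w (by simp [relators, hw])) (fun w hw => hone w (by simp [relators, hw]))
      hαβ
  · have hc := hcomm (by norm_num)
    refine pushRelations_of_recolour (by simp [dExp]) hc (third le_rfl) ?_
    intro α β γ h1 h2 h3 j w hw
    refine comm_of_three_colours hc ?_ hw h1 h2 h3 j
    intro α β γ h1 h2 h3 i l k
    have := hc.commute_commutator h1 h2 h3 (fun {α β} h {i j k} hij hik hjk => by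
      have := commute_of_relTriple (constCls (relators 4 r) N)
        (fun w hw => hone w (by simp [relators, hw]))
        (fun w hw => hone w (by simp [relators, hw])) h hij hik hjk (-1) 1
      simp only [Units.val_neg, Units.val_one, zpow_neg, zpow_one] at this
      have e := (hc.commute h k).inv_right.eq
      change Commute (cls _ N 0 _) ⁅(cls _ N 0 _)⁻¹, _⁆
      rw [← e]
      exact this) i l k
    simpa only [Comm, map_commutatorElement, map_mul, map_inv] using this
  · have hc := hcomm (by omega)
    have hd : dExp n = 2 := by
      rw [dExp, if_neg (by omega), if_neg (by omega)]
    rw [hd]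
    refine pushRelations_of_recolour (by norm_num) hc (third (by omega)) ?_
    intro α β γ h1 h2 h3 j w hw
    have := comm_vpow_of_four_colours hc (fun α β γ => by
      obtain ⟨δ, hδ⟩ := Fin.exists_notMem_of_card_lt {α, β, γ}
        (lt_of_le_of_lt Finset.card_le_three (by omega))
      exact ⟨δ, by simpa using hδ⟩) hw h1 h2 h3 j bounded_one
    rwa [vpow_one] at this

end Relators

/-! ### The area of words that represent the trivial element -/

section AreaBound

variable {n r : ℕ}

theorem heightLE_letterHeight {κ : Type*} (a : ProductLetter κ r) :
    HeightLE (letterHeight a) 1 := by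
  intro k
  have h0 : ((Pi.single a.2 1 : Fin r → ℤ) k).natAbs ≤ 1 := by
    by_cases h : k = a.2
    · rw [h, Pi.single_eq_same]; rfl
    · rw [Pi.single_eq_of_ne h]; simp
  obtain ⟨_ | α, i⟩ := a
  · exact h0
  · simpa [letterHeight] using h0

/-- The image in the kernel of a square at height at most `M` has area `O(M ^ d)`. -/
theorem exists_area_square_le (hn : 3 ≤ n) {c : Fin (n - 1) → Fin (n - 1)} (hc : ∀ α, α ≠ c α)
    (δ₀ : Fin (n - 1)) : ∃ C : ℕ, ∀ M : ℕ, ∀ a b : ProductLetter (Fin (n - 1)) r, a.1 ≠ b.1 →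
      ∀ v, HeightLE v M → area (relators n r)
        (crossed (pushLetter c δ₀) letterHeight v ⁅FreeGroup.of a, FreeGroup.of b⁆) ≤
          (C * (M + 1) ^ dExp n : ℕ) := by
  let T := {q : ℕ × (Fin r → ℤ) // HeightLE q.2 q.1}
  let N : T → ℕ := fun t => t.1.1
  let V : T → Fin r → ℤ := fun t => t.1.2
  have hV : ∀ t k, (V t k).natAbs ≤ N t := fun t k => t.2 k
  have h := pushRelations_relators (r := r) hn N
  have key : ∀ a b : ProductLetter (Fin (n - 1)) r, a.1 ≠ b.1 → Cong (relators n r) N (dExp n)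
      (fun t => crossed (pushLetter c δ₀) letterHeight (V t) (FreeGroup.of a * FreeGroup.of b))
      (fun t => crossed (pushLetter c δ₀) letterHeight (V t)
        (FreeGroup.of b * FreeGroup.of a)) := by
    have e : ∀ a b : ProductLetter (Fin (n - 1)) r,
        (fun t => crossed (pushLetter c δ₀) letterHeight (V t) (FreeGroup.of a * FreeGroup.of b)) =
        (fun t => pushLetter c δ₀ (V t) a) *
          fun t => pushLetter c δ₀ (V t + letterHeight a) b := by
      intro a b
      ext1 t
      rw [crossed_mul, crossed_of, crossed_of]
      simp [height]
    rintro ⟨_ | α, i⟩ ⟨_ | β, j⟩ hab <;> rw [e, e]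
    · exact absurd rfl hab
    · exact (pushLetter_square_last h hc δ₀ β j i hV).symm
    · exact pushLetter_square_last h hc δ₀ α i j hV
    · exact pushLetter_square h hc δ₀ (fun h => hab (by simp [h])) i j hV
  have key2 : ∀ q : ProductLetter (Fin (n - 1)) r × ProductLetter (Fin (n - 1)) r, ∃ C : ℕ,
      q.1.1 ≠ q.2.1 → ∀ t : T, area (relators n r)
        (crossed (pushLetter c δ₀) letterHeight (V t) ⁅FreeGroup.of q.1, FreeGroup.of q.2⁆) ≤
          (C * (N t + 1) ^ dExp n : ℕ) := by
    rintro ⟨a, b⟩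
    by_cases hab : a.1 = b.1
    · exact ⟨0, fun h => absurd hab h⟩
    · obtain ⟨C, hC⟩ := cong_iff.mp (key a b hab)
      refine ⟨C, fun _ t => ?_⟩
      rw [crossed_commutator]
      exact hC t
  choose C hC using key2
  refine ⟨∑ q, C q, fun M a b hab v hv => area_mono (hC (a, b) hab ⟨(M, v), hv⟩) ?_⟩
  exact Nat.mul_le_mul_right _ (Finset.single_le_sum (f := C) (fun _ _ => Nat.zero_le _)
    (Finset.mem_univ (a, b)))

/-- The word in the letters of the product that spells a word in the generators `x_i^{(α)}`. -/
def spell (κ : Type*) (r : ℕ) : FreeGroup (κ × Fin r) →* FreeGroup (ProductLetter κ r) :=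
  FreeGroup.lift fun q => FreeGroup.of (some q.1, q.2) * FreeGroup.of (none, q.2)

theorem height_spell {κ : Type*} (w : FreeGroup (κ × Fin r)) :
    height letterHeight (spell κ r w) = 1 := by
  have : (height letterHeight).comp (spell κ r) = 1 := by
    ext q
    simp [spell, height, letterHeight]
  exact DFunLike.congr_fun this w

theorem norm_spell_le {κ : Type*} [DecidableEq κ] (w : FreeGroup (κ × Fin r)) :
    (spell κ r w).norm ≤ 2 * w.norm := by
  have key : ∀ L : List ((κ × Fin r) × Bool), (spell κ r (FreeGroup.mk L)).norm ≤ 2 * L.length := by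
    intro L
    induction L with
    | nil => simp [mk_nil_eq_one]
    | cons x L ih =>
      rw [mk_cons, map_mul]
      refine (FreeGroup.norm_mul_le _ _).trans ?_
      have h2 : (spell κ r (FreeGroup.of x.1)).norm ≤ 2 := by
        simp only [spell, FreeGroup.lift_apply_of]
        exact (FreeGroup.norm_mul_le _ _).trans (by simp)
      have : (spell κ r (signed x)).norm ≤ 2 := by
        rcases signed_cases x with h | h <;> rw [h]
        · exact h2
        · rwa [map_inv, FreeGroup.norm_inv_eq]
      rw [List.length_cons]; omega
  have := key w.toWord
  rwa [FreeGroup.mk_toWord] at this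

theorem sectionWord_zero {κ : Type*} (α : κ) (L : List (Fin r)) : sectionWord α L 0 = 1 := by
  simp [sectionWord]

/-- The section is trivial at height `0`, and `x_i^{(α)}` is spelled `a_i^{(α)} b_i`, which runs
through heights `0`, `-e_i` and `0`; its image is the word `x_i^{(α)}` itself. -/
theorem crossed_spell {κ : Type*} (c : κ → κ) (δ₀ : κ) (w : FreeGroup (κ × Fin r)) :
    crossed (pushLetter c δ₀) letterHeight 0 (spell κ r w) = w := by
  induction w using FreeGroup.induction_on with
  | C1 => rw [map_one, crossed_one]
  | of q =>
    obtain ⟨α, i⟩ := q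
    have h1 : sectionWord (c δ₀) (seg r 0 r) (-Pi.single i 1) =
        sectionWord (c δ₀) (seg r 0 (i + 1)) (-Pi.single i 1) := by
      rw [seg_append (Nat.zero_le _) (show (i : ℕ) + 1 ≤ r from i.isLt), sectionWord, sectionWord,
        List.map_append, List.prod_append, mul_eq_left]
      refine List.prod_eq_one fun x hx => ?_
      obtain ⟨k, hk, rfl⟩ := List.mem_map.mp hx
      have : k ≠ i := by rintro rfl; have := (mem_seg.mp hk).1; omega
      simp [this]
    simp only [spell, FreeGroup.lift_apply_of, crossed_mul, crossed_of, height, letterHeight,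
      toAdd_ofAdd, zero_add, pushLetter, h1, mul_inv_cancel, mul_one, sectionWord_zero, one_mul,
      inv_one]
  | inv_of q ih => rw [map_inv, crossed_inv_of_height (height_spell _), ih]
  | mul v w hv hw => rw [map_mul, crossed_mul_of_height (height_spell _), hv, hw]

/-- The projection of a word to the letters of one factor. -/
def factorProj {A Φ : Type*} [DecidableEq Φ] (fac : A → Φ) (φ : Φ) : FreeGroup A →* FreeGroup A :=
  FreeGroup.lift fun a => if fac a = φ then FreeGroup.of a else 1

theorem factorProj_mk {A Φ : Type*} [DecidableEq Φ] (fac : A → Φ) (φ : Φ) (L : List (A × Bool)) :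
    factorProj fac φ (FreeGroup.mk L) = FreeGroup.mk (L.filter fun x => fac x.1 = φ) := by
  induction L with
  | nil => rw [List.filter_nil, mk_nil_eq_one, map_one]
  | cons x L ih =>
    have h : factorProj fac φ (signed x) = if fac x.1 = φ then signed x else 1 := by
      rcases signed_cases x with h | h <;> rw [h] <;> simp only [factorProj, map_inv,
        FreeGroup.lift_apply_of] <;> (split_ifs <;> simp)
    rw [mk_cons, map_mul, ih, h]
    by_cases hx : fac x.1 = φ
    · rw [if_pos hx, List.filter_cons_of_pos (by simpa using hx), mk_cons]
    · rw [if_neg hx, List.filter_cons_of_neg (by simpa using hx), one_mul]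

theorem firstFactor_injective : Function.Injective (firstFactor (n := n)) :=
  Fin.castLE_injective (Nat.sub_le n 1)

theorem firstFactor_ne_lastFactor (α β : Fin (n - 1)) : firstFactor α ≠ lastFactor β := by
  have := α.isLt
  simp only [firstFactor, lastFactor, ne_eq, Fin.ext_iff, Fin.val_castLE]
  omega

/-- The value of a word in the generators of the kernel, as an element of the product. -/
def wordValue (n r : ℕ) : KernelWord n r →* FreeProd n r :=
  (kernelK n r).subtype.comp (FreeGroup.lift (kernelGen n r))

theorem wordValue_letter (α : Fin (n - 1)) (i : Fin r) :
    wordValue n r (letter α i) =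
      factorGen (firstFactor α) i * (factorGen (lastFactor α) i)⁻¹ := by
  simp [wordValue, letter, kernelGen]

theorem wordValue_letter_first (α β : Fin (n - 1)) (i : Fin r) :
    wordValue n r (letter β i) (firstFactor α) = if β = α then FreeGroup.of i else 1 := by
  rw [wordValue_letter]
  have h1 := firstFactor_ne_lastFactor α β
  by_cases h : β = α
  · subst h
    simp [factorGen, Pi.mulSingle_eq_of_ne h1]
  · have h2 : firstFactor α ≠ firstFactor β := fun e => h (firstFactor_injective e).symm
    simp [factorGen, Pi.mulSingle_eq_of_ne h1, Pi.mulSingle_eq_of_ne h2, h]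

theorem wordValue_letter_last (α β : Fin (n - 1)) (i : Fin r) :
    wordValue n r (letter β i) (lastFactor α) = (FreeGroup.of i)⁻¹ := by
  rw [wordValue_letter]
  have h1 := (firstFactor_ne_lastFactor β α).symm
  have h2 : lastFactor α = lastFactor β := rfl
  simp only [factorGen, Pi.mul_apply, Pi.inv_apply, Pi.mulSingle_eq_of_ne h1, one_mul]
  rw [h2, Pi.mulSingle_eq_same]

/-- The spelling of a word that is trivial in the product is trivial in each of the factors. -/
theorem factorProj_spell_eq_one {w : KernelWord n r} (hw : wordValue n r w = 1)
    (φ : Option (Fin (n - 1))) : factorProj Prod.fst φ (spell (Fin (n - 1)) r w) = 1 := by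
  obtain _ | α := φ
  · by_cases hn : Nonempty (Fin (n - 1))
    · obtain ⟨α⟩ := hn
      have e : (factorProj Prod.fst none).comp (spell (Fin (n - 1)) r) =
          ((FreeGroup.lift fun i : Fin r =>
            (FreeGroup.of ((none : Option (Fin (n - 1))), i))⁻¹).comp
            (Pi.evalMonoidHom (fun _ : Fin n => FreeGroup (Fin r)) (lastFactor α))).comp
              (wordValue n r) := by
        ext q
        have := wordValue_letter_last α q.1 q.2
        rw [letter] at this
        simp [spell, factorProj, this]
      have := DFunLike.congr_fun e w
      simpa [hw] using this
    · have : w = 1 := by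
        have : IsEmpty (Fin (n - 1) × Fin r) := ⟨fun q => hn ⟨q.1⟩⟩
        exact Subsingleton.elim _ _
      rw [this, map_one, map_one]
  · have e : (factorProj Prod.fst (some α)).comp (spell (Fin (n - 1)) r) =
        ((FreeGroup.lift fun i : Fin r => (FreeGroup.of (some α, i))).comp
          (Pi.evalMonoidHom (fun _ : Fin n => FreeGroup (Fin r)) (firstFactor α))).comp
            (wordValue n r) := by
      ext q
      have := wordValue_letter_first α q.1 q.2
      rw [letter] at this
      by_cases h : q.1 = α
      · simp [spell, factorProj, this, h]
      · simp [spell, factorProj, this, h]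
    have := DFunLike.congr_fun e w
    simpa [hw] using this

/-- The isoperimetric inequality for the given presentation. -/
theorem exists_area_le_of_wordValue_eq_one (hn : 3 ≤ n) (r : ℕ) :
    ∃ C : ℕ, ∀ w : KernelWord n r, wordValue n r w = 1 →
      area (relators n r) w ≤ (C * (w.norm + 1) ^ (dExp n + 2) : ℕ) := by
  have hc : ∀ α : Fin (n - 1), ∃ β, α ≠ β := fun α => by
    obtain ⟨β, hβ⟩ := Fin.exists_notMem_of_card_lt {α} (by rw [Finset.card_singleton]; omega)
    exact ⟨β, fun h => hβ (by simp [h])⟩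
  choose c hc using hc
  obtain ⟨C, hC⟩ := exists_area_square_le (r := r) hn hc ⟨0, by omega⟩
  refine ⟨n * (2 ^ 2 * (C * 3 ^ dExp n)), fun w hw => ?_⟩
  set g := spell (Fin (n - 1)) r w with hg
  have h1 := area_crossed_mk_le (R := relators n r) (fac := Prod.fst) heightLE_letterHeight
    (hC (g.norm + 2)) Finset.univ.toList g.toWord (by simp)
    (fun φ => by rw [← factorProj_mk, FreeGroup.mk_toWord]; exact factorProj_spell_eq_one hw φ)
    (v := 0) (m := 0) (fun k => by simp) (by rw [FreeGroup.norm]; omega)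
  rw [FreeGroup.mk_toWord, hg, crossed_spell, ← hg] at h1
  refine area_mono h1 ?_
  have h2 : g.toWord.length ≤ 2 * w.norm := norm_spell_le w
  have h3 : g.norm ≤ 2 * w.norm := norm_spell_le w
  have h4 : (Finset.univ : Finset (Option (Fin (n - 1)))).toList.length = n := by
    simp; omega
  rw [h4]
  calc n * (g.toWord.length ^ 2 * (C * (g.norm + 2 + 1) ^ dExp n))
      ≤ n * ((2 * (w.norm + 1)) ^ 2 * (C * (3 * (w.norm + 1)) ^ dExp n)) := by
        gcongr <;> omega
    _ = _ := by rw [mul_pow, mul_pow, pow_add]; ring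

end AreaBound

/-! ### The presentation -/

section Presentation

variable {n r : ℕ}

theorem finite_relators : (relators n r).Finite := by
  have h1 : (relSimple n r).Finite := by
    refine (Set.finite_range fun q : Fin r × Fin (n - 1) × Fin (n - 1) =>
      ⁅letter q.2.1 q.1, letter q.2.2 q.1⁆).subset ?_
    rintro _ ⟨i, α, β, -, rfl⟩
    exact ⟨(i, α, β), rfl⟩
  have h2 : (relComm n r).Finite := by
    refine (Set.finite_range fun q : (Fin r × Fin r) × Fin (n - 1) × Fin (n - 1) × Fin (n - 1) =>
      ⁅letter q.2.1 q.1.1, letter q.2.2.1 q.1.2 * (letter q.2.2.2 q.1.2)⁻¹⁆).subset ?_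
    rintro _ ⟨i, j, α, β, γ, -, -, -, -, rfl⟩
    exact ⟨((i, j), α, β, γ), rfl⟩
  have h3 : (relSwap n r).Finite := by
    refine (Set.finite_range fun q : (Fin r × Fin r) × (Fin (n - 1) × Fin (n - 1)) × ℤˣ × ℤˣ =>
      ⁅letter q.2.1.1 q.1.1 ^ (q.2.2.1 : ℤ), letter q.2.1.2 q.1.2 ^ (q.2.2.2 : ℤ)⁆ *
      ⁅letter q.2.1.1 q.1.2 ^ (q.2.2.2 : ℤ), letter q.2.1.2 q.1.1 ^ (q.2.2.1 : ℤ)⁆).subset ?_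
    rintro _ ⟨i, j, α, β, ε, δ, -, -, rfl⟩
    exact ⟨((i, j), (α, β), ε, δ), rfl⟩
  have h4 : (relTriple n r).Finite := by
    refine (Set.finite_range
      fun q : (Fin r × Fin r × Fin r) × (Fin (n - 1) × Fin (n - 1)) × ℤˣ × ℤˣ =>
      ⁅letter q.2.1.1 q.1.1, ⁅letter q.2.1.2 q.1.2.1 ^ (q.2.2.1 : ℤ),
        letter q.2.1.1 q.1.2.2 ^ (q.2.2.2 : ℤ) *
          (letter q.2.1.2 q.1.2.2)⁻¹ ^ (q.2.2.2 : ℤ)⁆⁆).subset ?_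
    rintro _ ⟨i, j, k, α, β, ε, δ, -, -, -, -, rfl⟩
    exact ⟨((i, j, k), (α, β), ε, δ), rfl⟩
  have h5 : (relQuad n r).Finite := by
    refine (Set.finite_range fun q : (Fin r × Fin r × Fin r × Fin r) ×
        (Fin (n - 1) × Fin (n - 1)) × ℤˣ × ℤˣ × ℤˣ × ℤˣ =>
      ⁅⁅letter q.2.1.1 q.1.1 ^ (q.2.2.1 : ℤ), letter q.2.1.1 q.1.2.2.1 ^ (q.2.2.2.1 : ℤ) *
          (letter q.2.1.2 q.1.2.2.1)⁻¹ ^ (q.2.2.2.1 : ℤ)⁆,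
        ⁅letter q.2.1.2 q.1.2.1 ^ (q.2.2.2.2.1 : ℤ), letter q.2.1.1 q.1.2.2.2 ^ (q.2.2.2.2.2 : ℤ) *
          (letter q.2.1.2 q.1.2.2.2)⁻¹ ^ (q.2.2.2.2.2 : ℤ)⁆⁆).subset ?_
    rintro _ ⟨i, j, k, h, α, β, ε, δ, σ, τ, -, -, -, -, -, -, -, rfl⟩
    exact ⟨((i, j, k, h), (α, β), ε, δ, σ, τ), rfl⟩
  rw [relators]
  split_ifs
  exacts [((h1.union h3).union h4).union h5, (h1.union h2).union h4, h1.union h2]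

/-- Words are determined in the first factors by forgetting the other colours, and in the last
factor by forgetting all colours. -/
theorem wordValue_eq_one_of {w : KernelWord n r}
    (h1 : ∀ α : Fin (n - 1), wordValue n r w (firstFactor α) = 1)
    (h2 : ∀ α : Fin (n - 1), wordValue n r w (lastFactor α) = 1) (hn : 3 ≤ n) :
    wordValue n r w = 1 := by
  ext1 φ
  by_cases h : (φ : ℕ) < n - 1
  · exact h1 ⟨φ, h⟩
  · have : φ = lastFactor ⟨0, by omega⟩ := by
      have := φ.isLt
      simp only [lastFactor, Fin.ext_iff]; omega
    rw [this]; exact h2 _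

theorem wordValue_relator (hn : 3 ≤ n) {w : KernelWord n r} (hw : w ∈ relators n r) :
    wordValue n r w = 1 := by
  let f (γ : Fin (n - 1)) : KernelWord n r →* FreeGroup (Fin r) :=
    (Pi.evalMonoidHom (fun _ : Fin n => FreeGroup (Fin r)) (firstFactor γ)).comp (wordValue n r)
  let g (γ : Fin (n - 1)) : KernelWord n r →* FreeGroup (Fin r) :=
    (Pi.evalMonoidHom (fun _ : Fin n => FreeGroup (Fin r)) (lastFactor γ)).comp (wordValue n r)
  have hf : ∀ γ β i, f γ (letter β i) = if β = γ then FreeGroup.of i else 1 := fun γ β i =>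
    wordValue_letter_first γ β i
  have hg : ∀ γ β i, g γ (letter β i) = (FreeGroup.of i)⁻¹ := fun γ β i =>
    wordValue_letter_last γ β i
  have hw' : w ∈ relSimple n r ∨ w ∈ relComm n r ∨ w ∈ relSwap n r ∨ w ∈ relTriple n r ∨
      w ∈ relQuad n r := by
    rw [relators] at hw
    split_ifs at hw <;> simp only [Set.mem_union] at hw <;> tauto
  refine wordValue_eq_one_of (fun γ => ?_) (fun γ => ?_) hn
  · change f γ w = 1
    rcases hw' with ⟨i, α, β, h, rfl⟩ | ⟨i, j, α, β, δ, -, h1, h2, h3, rfl⟩ |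
      ⟨i, j, α, β, ε, δ, -, h, rfl⟩ | ⟨i, j, k, α, β, ε, δ, -, -, -, h, rfl⟩ |
      ⟨i, j, k, l, α, β, ε, δ, σ, τ, -, -, -, -, -, -, h, rfl⟩
    · by_cases hα : α = γ
      · subst hα; simp [map_commutatorElement, hf, h.symm]
      · simp [map_commutatorElement, hf, hα]
    · by_cases hα : α = γ
      · subst hα; simp [map_commutatorElement, hf, h1.symm, h2.symm]
      · simp [map_commutatorElement, hf, hα]
    · by_cases hα : α = γ
      · subst hα; simp [map_commutatorElement, hf, h.symm]
      · simp [map_commutatorElement, hf, hα]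
    · by_cases hα : α = γ
      · subst hα; simp [map_commutatorElement, hf, h.symm]
      · simp [map_commutatorElement, hf, hα]
    · by_cases hα : α = γ
      · subst hα; simp [map_commutatorElement, hf, h.symm]
      · simp [map_commutatorElement, hf, hα]
  · change g γ w = 1
    rcases hw' with ⟨i, α, β, h, rfl⟩ | ⟨i, j, α, β, δ, -, h1, h2, h3, rfl⟩ |
      ⟨i, j, α, β, ε, δ, -, h, rfl⟩ | ⟨i, j, k, α, β, ε, δ, -, -, -, h, rfl⟩ |
      ⟨i, j, k, l, α, β, ε, δ, σ, τ, -, -, -, -, -, -, h, rfl⟩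
    · simp [map_commutatorElement, hg]
    · simp [map_commutatorElement, hg]
    · simp only [map_mul, map_commutatorElement, map_zpow, hg]
      rw [← commutatorElement_inv, inv_mul_cancel]
    · simp [map_commutatorElement, hg]
    · simp [map_commutatorElement, hg]

theorem psi_mulSingle (α : Fin n) (g : FreeGroup (Fin r)) : psi n r (Pi.mulSingle α g) =
    FreeGroup.lift (fun i : Fin r =>
      Multiplicative.ofAdd (Pi.single i (1 : ℤ) : Fin r → ℤ)) g := by
  rw [psi, MonoidHom.finsetProd_apply, Finset.prod_eq_single α]
  · simp
  · intro β _ hβ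
    simp [Pi.mulSingle_eq_of_ne hβ]
  · simp

/-- An element of a free group with trivial exponent sums is a product of commutators. -/
theorem mem_commutator_of_lift_eq_one {g : FreeGroup (Fin r)}
    (hg : FreeGroup.lift (fun i : Fin r =>
      Multiplicative.ofAdd (Pi.single i (1 : ℤ) : Fin r → ℤ)) g = 1) :
    g ∈ commutator (FreeGroup (Fin r)) := by
  let s : Multiplicative (Fin r → ℤ) →* Abelianization (FreeGroup (Fin r)) :=
    { toFun := fun v => ∏ i, Abelianization.of (FreeGroup.of i) ^ (v.toAdd i)
      map_one' := by simp
      map_mul' := fun v w => by simp [zpow_add, Finset.prod_mul_distrib] }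
  have hs : s.comp (FreeGroup.lift fun i : Fin r =>
      Multiplicative.ofAdd (Pi.single i (1 : ℤ) : Fin r → ℤ)) = Abelianization.of := by
    ext i
    simp only [MonoidHom.comp_apply, FreeGroup.lift_apply_of, s, MonoidHom.coe_mk, OneHom.coe_mk,
      toAdd_ofAdd]
    rw [Finset.prod_eq_single i]
    · simp
    · intro j _ hj
      simp [Pi.single_eq_of_ne hj]
    · simp
  have := DFunLike.congr_fun hs g
  rw [MonoidHom.comp_apply, hg, map_one] at this
  rw [← Abelianization.ker_of]
  exact this.symm

/-- A word in the letters of one colour. -/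
def colourWord (n : ℕ) (α : Fin (n - 1)) : FreeGroup (Fin r) →* KernelWord n r :=
  FreeGroup.lift fun i => letter α i

theorem wordValue_colourWord_first (α β : Fin (n - 1)) (g : FreeGroup (Fin r)) :
    wordValue n r (colourWord n β g) (firstFactor α) = if β = α then g else 1 := by
  have : ((Pi.evalMonoidHom (fun _ : Fin n => FreeGroup (Fin r)) (firstFactor α)).comp
      (wordValue n r)).comp (colourWord n β) =
      if β = α then MonoidHom.id _ else 1 := by
    ext i
    have := wordValue_letter_first α β i
    by_cases h : β = α
    · rw [if_pos h] at this ⊢; simpa [colourWord] using this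
    · rw [if_neg h] at this ⊢; simpa [colourWord] using this
  have h2 := DFunLike.congr_fun this g
  by_cases h : β = α
  · rw [if_pos h] at h2 ⊢; exact h2
  · rw [if_neg h] at h2 ⊢; exact h2

theorem wordValue_colourWord_last (α β : Fin (n - 1)) (g : FreeGroup (Fin r)) :
    wordValue n r (colourWord n β g) (lastFactor α) =
      FreeGroup.lift (fun i => (FreeGroup.of i)⁻¹) g := by
  have : ((Pi.evalMonoidHom (fun _ : Fin n => FreeGroup (Fin r)) (lastFactor α)).comp
      (wordValue n r)).comp (colourWord n β) =
      FreeGroup.lift (fun i => (FreeGroup.of i)⁻¹) := by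
    ext i
    have := wordValue_letter_last α β i
    simpa [colourWord] using this
  exact DFunLike.congr_fun this g

/-- The commutator subgroup of the last factor is generated by words in the generators of the
kernel: a commutator is obtained by spelling its two entries in two different colours. -/
theorem mulSingle_lastFactor_mem_range (hn : 3 ≤ n) (α : Fin (n - 1)) {g : FreeGroup (Fin r)}
    (hg : g ∈ commutator (FreeGroup (Fin r))) :
    Pi.mulSingle (lastFactor α) g ∈ (wordValue n r).range := by
  suffices h : commutator (FreeGroup (Fin r)) ≤ (wordValue n r).range.comap
      (MonoidHom.mulSingle (fun _ : Fin n => FreeGroup (Fin r)) (lastFactor α)) from h hg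
  rw [commutator_def, Subgroup.commutator_le]
  intro u _ v _
  have hinv : ∀ g : FreeGroup (Fin r), FreeGroup.lift (fun i => (FreeGroup.of i)⁻¹)
      (FreeGroup.lift (fun i => (FreeGroup.of i)⁻¹) g) = g := by
    intro g
    have : (FreeGroup.lift (fun i : Fin r => (FreeGroup.of i)⁻¹)).comp
        (FreeGroup.lift (fun i : Fin r => (FreeGroup.of i)⁻¹)) = MonoidHom.id _ := by
      ext i; simp
    exact DFunLike.congr_fun this g
  let β : Fin (n - 1) := ⟨0, by omega⟩
  let γ : Fin (n - 1) := ⟨1, by omega⟩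
  have hβγ : β ≠ γ := by simp [β, γ]
  refine ⟨⁅colourWord n β (FreeGroup.lift (fun i => (FreeGroup.of i)⁻¹) u),
    colourWord n γ (FreeGroup.lift (fun i => (FreeGroup.of i)⁻¹) v)⁆, ?_⟩
  rw [map_commutatorElement]
  ext1 φ
  by_cases hφ : (φ : ℕ) < n - 1
  · obtain ⟨δ, rfl⟩ : ∃ δ : Fin (n - 1), φ = firstFactor δ := ⟨⟨φ, hφ⟩, rfl⟩
    simp only [commutatorElement_def, Pi.mul_apply, Pi.inv_apply, wordValue_colourWord_first,
      MonoidHom.mulSingle_apply, Pi.mulSingle_eq_of_ne (firstFactor_ne_lastFactor δ α)]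
    by_cases h : β = δ
    · have : γ ≠ δ := fun h' => hβγ (h.trans h'.symm)
      simp [this]
    · simp [h]
  · have : φ = lastFactor α := by
      have := φ.isLt
      simp only [lastFactor, Fin.ext_iff]; omega
    subst this
    simp only [commutatorElement_def, Pi.mul_apply, Pi.inv_apply, wordValue_colourWord_last,
      MonoidHom.mulSingle_apply, Pi.mulSingle_eq_same, hinv]

/-- The components of an element of the kernel in the first factors can be removed one at a time by
words in one colour; what is left lies in the commutator subgroup of the last factor. -/
theorem kernelK_le_range (hn : 3 ≤ n) : kernelK n r ≤ (wordValue n r).range := by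
  have hker : ∀ w, wordValue n r w ∈ kernelK n r := fun w => (FreeGroup.lift (kernelGen n r) w).2
  have key : ∀ (s : Finset (Fin (n - 1))) (k : FreeProd n r), k ∈ kernelK n r →
      (∀ α, α ∉ s → k (firstFactor α) = 1) → k ∈ (wordValue n r).range := by
    intro s
    induction s using Finset.induction_on with
    | empty =>
      intro k hk h
      let α : Fin (n - 1) := ⟨0, by omega⟩
      have e : k = Pi.mulSingle (lastFactor α) (k (lastFactor α)) := by
        ext1 φ
        by_cases hφ : (φ : ℕ) < n - 1
        · obtain ⟨δ, rfl⟩ : ∃ δ : Fin (n - 1), φ = firstFactor δ := ⟨⟨φ, hφ⟩, rfl⟩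
          rw [h δ (Finset.notMem_empty _), Pi.mulSingle_eq_of_ne (firstFactor_ne_lastFactor δ α)]
        · have : φ = lastFactor α := by
            have := φ.isLt
            simp only [lastFactor, Fin.ext_iff]; omega
          rw [this, Pi.mulSingle_eq_same]
      rw [e]
      refine mulSingle_lastFactor_mem_range hn α (mem_commutator_of_lift_eq_one ?_)
      rw [← psi_mulSingle (lastFactor α), ← e]
      exact hk
    | insert α s hα ih =>
      intro k hk h
      set w := colourWord n α (k (firstFactor α)) with hw
      have := ih (k * (wordValue n r w)⁻¹) (mul_mem hk (inv_mem (hker w))) (by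
        intro β hβ
        rw [Pi.mul_apply, Pi.inv_apply, hw, wordValue_colourWord_first]
        by_cases hαβ : α = β
        · subst hαβ; simp
        · rw [if_neg hαβ, h β (by simp [hβ, Ne.symm hαβ]), inv_one, mul_one])
      simpa using mul_mem this ⟨w, rfl⟩
  intro k hk
  exact key Finset.univ k hk (fun α hα => absurd (Finset.mem_univ α) hα)

theorem wordValue_eq_one_iff (w : KernelWord n r) :
    wordValue n r w = 1 ↔ FreeGroup.lift (kernelGen n r) w = 1 := by
  rw [wordValue, MonoidHom.comp_apply, Subgroup.coe_subtype, OneMemClass.coe_eq_one]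

theorem isFinitePresentation_kernelK (hn : 3 ≤ n) (r : ℕ) :
    IsFinitePresentation (kernelGen n r) (relators n r) := by
  refine ⟨inferInstance, finite_relators, fun k => ?_, le_antisymm (fun w hw => ?_) ?_⟩
  · obtain ⟨w, hw⟩ := kernelK_le_range hn k.2
    exact ⟨w, Subtype.ext hw⟩
  · obtain ⟨C, hC⟩ := exists_area_le_of_wordValue_eq_one hn r
    exact mem_normalClosure_of_area_le (hC w ((wordValue_eq_one_iff w).mpr hw))
  · exact Subgroup.normalClosure_le_normal fun w hw =>
      (wordValue_eq_one_iff w).mp (wordValue_relator hn hw)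

end Presentation

/-! ### Independence of the presentation -/

section Independence

variable {S S' G : Type*} [Group G] {R : Set (FreeGroup S)} {R' : Set (FreeGroup S')}

theorem area_map_le {Ψ : FreeGroup S →* FreeGroup S'} {m : ℕ} (h : ∀ ρ ∈ R, area R' (Ψ ρ) ≤ m)
    {w : FreeGroup S} {k : ℕ} (hw : area R w ≤ k) : area R' (Ψ w) ≤ (k * m : ℕ) := by
  obtain ⟨l, ⟨hl, rfl⟩, hk⟩ := area_le_iff.mp hw
  refine area_mono (k := l.length * m) ?_ (Nat.mul_le_mul_right _ hk)
  clear hk hw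
  induction l with
  | nil => simpa using area_one_le
  | cons p l ih =>
    have h1 : area R' (Ψ p.2) ≤ m := by
      rcases hl p (by simp) with h2 | h2
      · exact h _ h2
      · have := area_inv_le (h _ h2)
        rwa [map_inv, inv_inv] at this
    have h2 := area_conj_le (Ψ p.1)⁻¹ h1
    rw [inv_inv] at h2
    rw [List.map_cons, List.prod_cons, map_mul, map_mul, map_mul, map_inv]
    exact area_mono (area_mul_le h2 (ih fun q hq => hl q (by simp [hq])))
      (by rw [List.length_cons]; ring_nf; omega)

theorem norm_lift_le [DecidableEq S] [DecidableEq S'] {Φ : FreeGroup S →* FreeGroup S'} {c : ℕ}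
    (h : ∀ s, (Φ (FreeGroup.of s)).norm ≤ c) (w : FreeGroup S) : (Φ w).norm ≤ w.norm * c := by
  have key : ∀ L : List (S × Bool), (Φ (FreeGroup.mk L)).norm ≤ L.length * c := by
    intro L
    induction L with
    | nil => simp [mk_nil_eq_one]
    | cons x L ih =>
      rw [mk_cons, map_mul]
      refine (FreeGroup.norm_mul_le _ _).trans ?_
      have : (Φ (signed x)).norm ≤ c := by
        rcases signed_cases x with e | e <;> rw [e]
        · exact h _
        · rw [map_inv, FreeGroup.norm_inv_eq]; exact h _
      rw [List.length_cons, add_mul, one_mul]; omega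
  have := key w.toWord
  rwa [FreeGroup.mk_toWord] at this

theorem area_mul_inv_map_le [DecidableEq S] {Ψ : FreeGroup S →* FreeGroup S} {m : ℕ}
    (h : ∀ s, area R (FreeGroup.of s * (Ψ (FreeGroup.of s))⁻¹) ≤ m) (w : FreeGroup S) :
    area R (w * (Ψ w)⁻¹) ≤ (w.norm * m : ℕ) := by
  have key : ∀ L : List (S × Bool),
      area R (FreeGroup.mk L * (Ψ (FreeGroup.mk L))⁻¹) ≤ (L.length * m : ℕ) := by
    intro L
    induction L with
    | nil => simpa [mk_nil_eq_one] using area_one_le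
    | cons x L ih =>
      have h1 : area R (signed x * (Ψ (signed x))⁻¹) ≤ m := by
        rcases signed_cases x with e | e <;> rw [e]
        · exact h _
        · have := area_inv_le (area_conj_le (FreeGroup.of x.1)⁻¹ (h x.1))
          rw [map_inv, inv_inv]
          convert this using 1
          group
      have h2 := area_mul_le (area_conj_le (signed x) ih) h1
      rw [mk_cons, map_mul]
      refine area_mono ?_ (show L.length * m + m ≤ (x :: L).length * m by
        rw [List.length_cons, add_mul, one_mul])
      convert h2 using 1
      group
  have := key w.toWord
  rwa [FreeGroup.mk_toWord] at this

/-- A polynomial isoperimetric inequality for one finite presentation bounds the Dehn function of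
every finite presentation. -/
theorem dehnFunctionLE_of_area_le [DecidableEq S] {ι : S → G} (h : IsFinitePresentation ι R)
    {C k : ℕ} (hC : ∀ w, FreeGroup.lift ι w = 1 → area R w ≤ (C * (w.norm + 1) ^ k : ℕ)) :
    DehnFunctionLE G (fun N => N ^ k) := by
  intro S' _ ι' R' h'
  obtain ⟨hS, hR, hsurj, hker⟩ := h
  obtain ⟨hS', hR', hsurj', hker'⟩ := h'
  choose φ hφ using fun s => hsurj (ι' s)
  choose ψ hψ using fun s => hsurj' (ι s)
  set Φ := FreeGroup.lift φ with hΦ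
  set Ψ := FreeGroup.lift ψ with hΨ
  have hΦ' : ∀ w, FreeGroup.lift ι (Φ w) = FreeGroup.lift ι' w := fun w => by
    have : (FreeGroup.lift ι).comp Φ = FreeGroup.lift ι' := by ext s; simp [hΦ, hφ]
    exact DFunLike.congr_fun this w
  have hΨ' : ∀ w, FreeGroup.lift ι' (Ψ w) = FreeGroup.lift ι w := fun w => by
    have : (FreeGroup.lift ι').comp Ψ = FreeGroup.lift ι := by ext s; simp [hΨ, hψ]
    exact DFunLike.congr_fun this w
  have harea : ∀ w, FreeGroup.lift ι' w = 1 → ∃ m : ℕ, area R' w ≤ m := fun w hw =>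
    exists_area_le_of_mem_normalClosure (by rw [← hker']; exact hw)
  obtain ⟨c, hc⟩ : ∃ c, ∀ s, (Φ (FreeGroup.of s)).norm ≤ c := by
    obtain ⟨c, hc⟩ := (Set.finite_range fun s => (Φ (FreeGroup.of s)).norm).bddAbove
    exact ⟨c, fun s => hc ⟨s, rfl⟩⟩
  obtain ⟨m₁, hm₁⟩ : ∃ m : ℕ, ∀ ρ ∈ R, area R' (Ψ ρ) ≤ m := by
    have h1 : ∀ ρ : R, ∃ m : ℕ, area R' (Ψ ρ) ≤ m := fun ρ => harea _ (by
      rw [hΨ', ← MonoidHom.mem_ker, hker]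
      exact Subgroup.subset_normalClosure ρ.2)
    choose f hf using h1
    have := hR.to_subtype
    obtain ⟨m, hm⟩ := (Set.finite_range f).bddAbove
    exact ⟨m, fun ρ hρ => area_mono (hf ⟨ρ, hρ⟩) (hm ⟨_, rfl⟩)⟩
  obtain ⟨m₂, hm₂⟩ : ∃ m : ℕ, ∀ s, area R' (FreeGroup.of s *
      ((Ψ.comp Φ) (FreeGroup.of s))⁻¹) ≤ m := by
    have h1 : ∀ s, ∃ m : ℕ, area R' (FreeGroup.of s * ((Ψ.comp Φ) (FreeGroup.of s))⁻¹) ≤ m :=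
      fun s => harea _ (by rw [map_mul, map_inv, MonoidHom.comp_apply, hΨ', hΦ', mul_inv_cancel])
    choose f hf using h1
    obtain ⟨m, hm⟩ := (Set.finite_range f).bddAbove
    exact ⟨m, fun s => area_mono (hf s) (hm ⟨s, rfl⟩)⟩
  refine ⟨m₂ + C * m₁ + c + 1, by omega, fun N _ => iSup₂_le fun w hw => ?_⟩
  have h1 := hC (Φ w) (by rw [hΦ']; exact hw.2)
  have h2 := area_mul_le (area_mul_inv_map_le hm₂ w) (area_map_le hm₁ h1)
  rw [MonoidHom.comp_apply, inv_mul_cancel_right] at h2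
  refine area_mono h2 ?_
  have h3 : (Φ w).norm + 1 ≤ (m₂ + C * m₁ + c + 1) * N + (m₂ + C * m₁ + c + 1) := by
    have := (norm_lift_le hc w).trans (Nat.mul_le_mul_right c hw.1)
    nlinarith [Nat.zero_le (m₂ * N), Nat.zero_le (C * m₁ * N)]
  have h4 : w.norm * m₂ ≤ (m₂ + C * m₁ + c + 1) * N := by
    rw [mul_comm]; gcongr
    · omega
    · exact hw.1
  have h5 : C * ((Φ w).norm + 1) ^ k * m₁ ≤ (m₂ + C * m₁ + c + 1) *
      ((m₂ + C * m₁ + c + 1) * N + (m₂ + C * m₁ + c + 1)) ^ k := by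
    rw [mul_right_comm]; gcongr; omega
  beta_reduce
  omega

end Independence

theorem mainTheorem4 (n r : ℕ) (hn : 3 ≤ n) (hr : 2 ≤ r) :
    IsFinitePresentation (kernelGen n r) (relators n r) ∧
      DehnFunctionLE (kernelK n r) (fun N => N ^ (dExp n + 2)) := by
  have h := isFinitePresentation_kernelK hn r
  obtain ⟨C, hC⟩ := exists_area_le_of_wordValue_eq_one hn r
  exact ⟨h, dehnFunctionLE_of_area_le h fun w hw => hC w ((wordValue_eq_one_iff w).mpr hw)⟩
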